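/- Let $\mathbb F=\mathbb R$ or $\mathbb C$, let $T>0$, and let $g:\mathbb R\to\mathbb R$ be nondecreasing and left-continuous. Let $\mu_g$ be the Lebesgue--Stieltjes measure with $\mu_g([c,d))=g(d)-g(c)$, put $\Delta^+g(t)=g(t^+)-g(t)$ and $D_g=\{t:\Delta^+g(t)>0\}$, and let $C_g$ be the set of points having a neighbourhood on which $g$ is constant. For $F:[a,b]\to\mathbb F$ and $t\in[a,b]$, the $g$-derivative is $$F'_g(t)=\begin{cases}\displaystyle\lim_{s\to t}\frac{F(s)-F(t)}{g(s)-g(t)}, & t\notin D_g\cup C_g,\\[2mm] \displaystyle\lim_{s\to t^+}\frac{F(s)-F(t)}{g(s)-g(t)}, & t\in D_g,\\[2mm] \displaystyle\lim_{s\to q^+}\frac{F(s)-F(q)}{g(s)-g(q)}, & t\in C_g,\end{cases}$$ when the limit exists; here $s$ ranges over the points of $[a,b]$ at which the quotient is defined, and $q$ is the right endpoint of the connected component of $C_g$ containing $t$. A function $F:[a,b]\to\mathbb F$ is $g$-absolutely continuous, $F\in\mathcal{AC}_g([a,b];\mathbb F)$, if for every $\varepsilon>0$ there is $\delta>0$ such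 that $\sum_i|F(q_i)-F(p_i)|<\varepsilon$ for every finite family of pairwise disjoint open subintervals $(p_i,q_i)$ of $[a,b]$ with $\sum_i(g(q_i)-g(p_i))<\delta$. Let $\beta,f\in\mathcal L^1_g([0,T);\mathbb F)$, that is, $\mu_g$-measurable and $\mu_g$-integrable on $[0,T)$, and let $v_0\in\mathbb F$. Put $T^0_\beta=\{t\in[0,T)\cap D_g:\ 1+\beta(t)\Delta^+g(t)=0\}$, and let $t^0_\beta=\min T^0_\beta$ if $T^0_\beta\neq\emptyset$ and $t^0_\beta=T$ otherwise. Define the $g$-exponential by $$\exp_g(\beta;0,t)=\exp\Big(\int_{[0,t)}\widetilde\beta\,d\mu_g\Big)\ \ (0\le t\le t^0_\beta),\qquad \exp_g(\beta;0,t)=0\ \ (t^0_\beta<t\le T),$$ where $\widetilde\beta(t)=\beta(t)$ for $t\notin D_g$ and $\widetilde\beta(t)=\ln(1+\beta(t)\Delta^+g(t))/\Delta^+g(t)$ for $t\in D_g$, with $\ln$ the principal branch of the complex logarithm (for $\mathbb F=\mathbb R$ the values of $\exp_g(\beta;0,\cdot)$ are real). Then $T^0_\beta$ is finite, $\exp_g(\beta;0,t)\neq0$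 for all $t\in[0,t^0_\beta]$, the function $s\mapsto\exp_g(\beta;0,s)^{-1}\frac{f(s)}{1+\beta(s)\Delta^+g(s)}$ is $\mu_g$-integrable on $[0,t^0_\beta)$, and the function $$v(t)=v_0\exp_g(\beta;0,t)+\exp_g(\beta;0,t)\int_{[0,t)}\exp_g(\beta;0,s)^{-1}\frac{f(s)}{1+\beta(s)\Delta^+g(s)}\,d\mu_g(s),\qquad t\in[0,t^0_\beta],$$ is the unique $v\in\mathcal{AC}_g([0,t^0_\beta];\mathbb F)$ such that $$v'_g(t)=\beta(t)v(t)+f(t)\ \text{ for } \mu_g\text{-a.e. } t\in[0,t^0_\beta),\qquad v(0)=v_0.$$ Moreover, with the Green's function $$G(t,s)=\exp_g(\beta;0,t)\,\frac{\exp_g(\beta;0,s)^{-1}}{1+\beta(s)\Delta^+g(s)}\,\chi_{[0,t)}(s),$$ for every $t\in[0,t^0_\beta]$ the function $s\mapsto G(t,s)f(s)$ is $\mu_g$-integrable on $[0,T]$, and this solution is $v(t)=v_0\exp_g(\beta;0,t)+\int_{[0,T]}G(t,s)f(s)\,d\mu_g(s)$. -/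

import Mathlib

open Set Filter Topology MeasureTheory

noncomputable section

/-- A derivator: a nondecreasing, left-continuous function `ℝ → ℝ`. -/
structure Derivator where
  toFun : ℝ → ℝ
  monotone' : Monotone toFun
  leftContinuous' : ∀ t, ContinuousWithinAt toFun (Iic t) t

namespace Derivator

instance : CoeFun Derivator (fun _ => ℝ → ℝ) := ⟨Derivator.toFun⟩

/-- The Lebesgue–Stieltjes measure `μ_g`. Mathlib's Stieltjes functions are right-continuous, so it
is built from the right-limit function of `g`; see `Derivator.measure_Ico`. -/
def measure (g : Derivator) : Measure ℝ := g.monotone'.stieltjesFunction.measure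

/-- `μ_g` is the Lebesgue–Stieltjes measure with `μ_g([c,d)) = g(d) - g(c)`. -/
theorem measure_Ico (g : Derivator) (c d : ℝ) :
    g.measure (Ico c d) = ENNReal.ofReal (g d - g c) := by
  have key : ∀ x, Function.leftLim g.monotone'.stieltjesFunction x = g x := by
    intro x
    have h1 : (g.monotone'.stieltjesFunction : ℝ → ℝ) = Function.rightLim g.toFun := by
      ext y
      exact g.monotone'.stieltjesFunction_eq y
    rw [h1, leftLim_rightLim (g.monotone'.tendsto_leftLim x)]
    exact leftLim_eq_of_tendsto
      (((g.leftContinuous' x).mono Iio_subset_Iic_self : ContinuousWithinAt g.toFun (Iio x) x))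
  rw [measure, StieltjesFunction.measure_Ico, key, key]

/-- The jump `Δ⁺g(t) = g(t⁺) - g(t)`. -/
def jump (g : Derivator) (t : ℝ) : ℝ := Function.rightLim g.toFun t - g t

/-- `D_g`, the set of discontinuity points of `g`. -/
def D (g : Derivator) : Set ℝ := {t | 0 < g.jump t}

/-- `C_g`, the set of points around which `g` is locally constant. -/
def C (g : Derivator) : Set ℝ :=
  {t | ∃ ε > 0, ∀ s ∈ Ioo (t - ε) (t + ε), g s = g t}

variable {𝕜 : Type*} [RCLike 𝕜]

/-- The quotient `(F s - F p) / (g s - g p)` tends to `d` as `s → p` within `S`, where `p` is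
required to be in the closure of `S`, so that the limit is meaningful. -/
def HasQuotientLimit (g : Derivator) (F : ℝ → 𝕜) (S : Set ℝ) (p : ℝ) (d : 𝕜) : Prop :=
  (𝓝[S] p).NeBot ∧
    Tendsto (fun s => (F s - F p) / ((g s - g p : ℝ) : 𝕜)) (𝓝[S] p) (𝓝 d)

/-- The Stieltjes derivative at `t ∈ [a,b]` of a function `F` on `[a,b]` exists and equals `d`.
* `t ∉ D_g ∪ C_g`: the limit as `s → t` over the `s ∈ [a,b]` where the quotient is defined
  (at an endpoint of a component of `C_g` this is the one-sided limit);
* `t ∈ D_g`: the limit as `s → t⁺`;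
* `t ∈ C_g`: the limit of the quotient based at `q` as `s → q⁺`, where `q` is the right endpoint of
  the component of `C_g` containing `t`. -/
def HasGDerivAt (g : Derivator) (a b : ℝ) (F : ℝ → 𝕜) (t : ℝ) (d : 𝕜) : Prop :=
  t ∈ Icc a b ∧
    ((t ∉ g.D ∪ g.C ∧ g.HasQuotientLimit F {s | s ∈ Icc a b ∧ g s ≠ g t} t d) ∨
     (t ∈ g.D ∧ g.HasQuotientLimit F (Ioc t b) t d) ∨
     (t ∈ g.C ∧ ∃ q, IsLUB (connectedComponentIn g.C t) q ∧
        g.HasQuotientLimit F {s | s ∈ Icc a b ∧ q < s} q d))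

/-- `F ∈ AC_g([a,b]; 𝕜)`: for every `ε > 0` there is `δ > 0` such that for every finite family of
pairwise disjoint open subintervals `(pᵢ,qᵢ)` of `[a,b]` with `∑ (g(qᵢ) - g(pᵢ)) < δ` one has
`∑ |F(qᵢ) - F(pᵢ)| < ε`. -/
def AbsCont (g : Derivator) (a b : ℝ) (F : ℝ → 𝕜) : Prop :=
  ∀ ε > 0, ∃ δ > 0, ∀ (n : ℕ) (p q : Fin n → ℝ),
    (∀ i, a ≤ p i ∧ p i < q i ∧ q i ≤ b) →
    (Pairwise fun i j => Disjoint (Ioo (p i) (q i)) (Ioo (p j) (q j))) →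
    ∑ i, (g (q i) - g (p i)) < δ → ∑ i, ‖F (q i) - F (p i)‖ < ε

/-- `T_β⁰ = {t ∈ [0,T) ∩ D_g : 1 + β(t) Δ⁺g(t) = 0}`. -/
def zeroSet (g : Derivator) (β : ℝ → 𝕜) (T : ℝ) : Set ℝ :=
  {t | t ∈ Ico 0 T ∩ g.D ∧ 1 + β t * (g.jump t : 𝕜) = 0}

open Classical in
/-- `t_β⁰ = min T_β⁰` if `T_β⁰ ≠ ∅`, and `t_β⁰ = T` otherwise (for `β` integrable on `[0,T)` the set
`T_β⁰` is finite, so that its infimum is its minimum). -/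
def tZero (g : Derivator) (β : ℝ → 𝕜) (T : ℝ) : ℝ :=
  if (g.zeroSet β T).Nonempty then sInf (g.zeroSet β T) else T

open Classical in
/-- `β̃ : ℝ → ℂ`, equal to `β` off `D_g` and to `ln(1 + β Δ⁺g) / Δ⁺g` on `D_g`, with the principal
branch of the complex logarithm. -/
def betaTilde (g : Derivator) (β : ℝ → 𝕜) (t : ℝ) : ℂ :=
  if t ∈ g.D then Complex.log (1 + RCLike.map 𝕜 ℂ (β t) * (g.jump t : ℂ)) / (g.jump t : ℂ)
  else RCLike.map 𝕜 ℂ (β t)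

open Classical in
/-- The `g`-exponential `exp_g(β;0,t)`, `t ∈ [0,T]`: it is `exp (∫_{[0,t)} β̃ dμ_g)` for
`t ≤ t_β⁰` and `0` for `t > t_β⁰`. The map `RCLike.map ℂ 𝕜` is the identity for `𝕜 = ℂ`; for
`𝕜 = ℝ` it identifies the complex number (which is then real) with a real number. -/
def gExp (g : Derivator) (β : ℝ → 𝕜) (T t : ℝ) : 𝕜 :=
  if t ≤ g.tZero β T then
    RCLike.map ℂ 𝕜 (Complex.exp (∫ s in Ico 0 t, g.betaTilde β s ∂g.measure))
  else 0

/-- `v` solves `v'_g(t) = β(t) v(t) + f(t)` for `g`-a.e. `t ∈ [0,τ)`, `v(0) = v₀`, in the space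
`AC_g([0,τ]; 𝕜)`. -/
def IsSolution (g : Derivator) (β f : ℝ → 𝕜) (v₀ : 𝕜) (τ : ℝ) (v : ℝ → 𝕜) : Prop :=
  g.AbsCont 0 τ v ∧ v 0 = v₀ ∧
    ∀ᵐ t ∂(g.measure.restrict (Ico 0 τ)), g.HasGDerivAt 0 τ v t (β t * v t + f t)

/-- The integrand `exp_g(β;0,s)⁻¹ f(s) / (1 + β(s) Δ⁺g(s))`. -/
def vocIntegrand (g : Derivator) (β f : ℝ → 𝕜) (T s : ℝ) : 𝕜 :=
  (g.gExp β T s)⁻¹ * (f s / (1 + β s * (g.jump s : 𝕜)))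

/-- The variation-of-constants formula
`v₀ exp_g(β;0,t) + exp_g(β;0,t) ∫_{[0,t)} exp_g(β;0,s)⁻¹ f(s) / (1 + β(s) Δ⁺g(s)) dμ_g(s)`. -/
def voc (g : Derivator) (β f : ℝ → 𝕜) (v₀ : 𝕜) (T t : ℝ) : 𝕜 :=
  v₀ * g.gExp β T t + g.gExp β T t * ∫ s in Ico 0 t, g.vocIntegrand β f T s ∂g.measure

/-- The first-order Green's function
`G(t,s) = exp_g(β;0,t) exp_g(β;0,s)⁻¹ / (1 + β(s) Δ⁺g(s)) χ_{[0,t)}(s)`. -/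
def green (g : Derivator) (β : ℝ → 𝕜) (T t s : ℝ) : 𝕜 :=
  (Ico 0 t).indicator
    (fun s => g.gExp β T t * ((g.gExp β T s)⁻¹ / (1 + β s * (g.jump s : 𝕜)))) s

end Derivator

end

noncomputable section

namespace Derivator

variable {𝕜 : Type*} [RCLike 𝕜]

/-! Write E for the `g`-exponential, Δ for the jump of `g` and τ for `tZero`. The proof is variation
of constants, with a calculus that sees jumps: if F has `g`-derivative d at t, then F(s) tends to
F(t) + dΔ along the admissible s, not to F(t). The product rule becomes (FH)' = F'(H + H'Δ) + FH',
and the chain rule uses the slope of φ between F(t) and F(t) + dΔ. As the exponential of the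
primitive of β̃, E satisfies E' = βE, since exp(β̃Δ) = 1 + βΔ at a jump. Differentiating (v₀ + ∫k)E
gives kE(1 + βΔ) + βv, which forces the integrand k = E⁻¹f/(1 + βΔ). For uniqueness, the difference
of two solutions times E⁻¹ has zero derivative almost everywhere.

Two theorems carry this. `ae_hasQuotientLimit_setIntegral` differentiates indefinite integrals: a
generalized inverse of `g` turns μ_g into Lebesgue measure, and atoms are treated directly.
`AbsCont.eq_of_hasQuotientLimit_zero` says that zero derivative almost everywhere forces constancy;
it is proved by continuous induction.

All integrability rests on `finite_half_le_jump`: off a finite set |βΔ| < 1/2, so log(1 + βΔ) is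
controlled by βΔ and 1 + βΔ stays away from 0. -/

instance isLocallyFiniteMeasure_measure (g : Derivator) : IsLocallyFiniteMeasure g.measure := by
  unfold measure; infer_instance

/-! ### Jumps, atoms of the measure, and the domain of the difference quotient. -/

theorem mono (g : Derivator) {s t : ℝ} (h : s ≤ t) : g s ≤ g t := g.monotone' h

theorem jump_nonneg (g : Derivator) (t : ℝ) : 0 ≤ g.jump t :=
  sub_nonneg.2 (g.monotone'.le_rightLim le_rfl)

theorem jump_eq_zero (g : Derivator) {t : ℝ} (ht : t ∉ g.D) : g.jump t = 0 :=
  le_antisymm (not_lt.1 ht) (g.jump_nonneg t)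

theorem tendsto_sub_nhdsGT (g : Derivator) (t : ℝ) :
    Tendsto (fun s => g s - g t) (𝓝[>] t) (𝓝 (g.jump t)) :=
  (g.monotone'.tendsto_rightLim t).sub_const (g t)

theorem jump_le (g : Derivator) {s t : ℝ} (h : t < s) : g.jump t ≤ g s - g t :=
  sub_le_sub_right (g.monotone'.rightLim_le h) _

theorem continuousAt (g : Derivator) {t : ℝ} (ht : t ∉ g.D) : ContinuousAt g t := by
  refine continuousAt_iff_continuous_left'_right'.2
    ⟨(g.leftContinuous' t).mono Iio_subset_Iic_self, ?_⟩
  have := (g.tendsto_sub_nhdsGT t).add_const (g t)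
  simpa [ContinuousWithinAt, g.jump_eq_zero ht] using this

theorem not_continuousAt (g : Derivator) {t : ℝ} (ht : t ∈ g.D) : ¬ ContinuousAt g t := by
  intro h
  have h1 : Tendsto (fun s => g s - g t) (𝓝[>] t) (𝓝 (g t - g t)) :=
    (h.tendsto.mono_left nhdsWithin_le_nhds).sub_const _
  have h2 := tendsto_nhds_unique h1 (g.tendsto_sub_nhdsGT t)
  rw [sub_self] at h2
  exact absurd h2.symm (ne_of_gt ht)

theorem countable_D (g : Derivator) : g.D.Countable :=
  g.monotone'.countable_not_continuousAt.mono fun _ => g.not_continuousAt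

theorem measure_singleton (g : Derivator) (t : ℝ) :
    g.measure {t} = ENNReal.ofReal (g.jump t) := by
  have h1 : ⋂ r, ⋂ (_ : r > t), Ico t r = {t} := by
    ext x
    simp only [mem_singleton_iff, mem_iInter, mem_Ico]
    constructor
    · intro h
      exact le_antisymm (le_of_forall_gt_imp_ge_of_dense fun r hr => (h r hr).2.le)
        (h (t + 1) (by simp)).1
    · rintro rfl r hr
      exact ⟨le_rfl, hr⟩
  have h2 := tendsto_measure_biInter_gt (μ := g.measure) (s := fun r => Ico t r) (a := t)
    (fun r _ => measurableSet_Ico.nullMeasurableSet)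
    (fun i j _ hij => Ico_subset_Ico_right hij)
    ⟨t + 1, by simp, by rw [g.measure_Ico]; exact ENNReal.ofReal_ne_top⟩
  rw [h1] at h2
  refine tendsto_nhds_unique h2 ?_
  simp only [Function.comp_def, g.measure_Ico]
  exact ENNReal.tendsto_ofReal (g.tendsto_sub_nhdsGT t)

theorem measureReal_singleton (g : Derivator) (t : ℝ) : g.measure.real {t} = g.jump t := by
  rw [Measure.real, measure_singleton, ENNReal.toReal_ofReal (g.jump_nonneg t)]

/-- Each point of `C` has a null neighbourhood. Hence the third case in the definition of the
derivative never matters almost everywhere. -/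
theorem measure_C (g : Derivator) : g.measure g.C = 0 := by
  refine measure_null_of_locally_null _ fun t ht => ?_
  obtain ⟨ε, hε, h⟩ := ht
  refine ⟨Ico (t - ε / 2) (t + ε / 2), mem_nhdsWithin_of_mem_nhds
    (Ico_mem_nhds (by linarith) (by linarith)), ?_⟩
  rw [g.measure_Ico, h (t + ε / 2) ⟨by linarith, by linarith⟩,
    h (t - ε / 2) ⟨by linarith, by linarith⟩]
  simp

theorem ae_notMem_C (g : Derivator) : ∀ᵐ t ∂g.measure, t ∉ g.C :=
  measure_eq_zero_iff_ae_notMem.1 g.measure_C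

/-- The points over which the quotient defining the derivative at `t ∉ C_g` is taken. -/
def quotSet (g : Derivator) (a b t : ℝ) : Set ℝ :=
  {s | s ∈ Icc a b ∧ g s ≠ g t ∧ (t ∈ g.D → t < s)}

/-- The continuity and jump cases merge into one limit: to the right of a jump, `g s ≠ g t` is
automatic. -/
theorem hasGDerivAt_iff (g : Derivator) {a b t : ℝ} {F : ℝ → 𝕜} {d : 𝕜} (ht : t ∈ Icc a b)
    (hC : t ∉ g.C) : g.HasGDerivAt a b F t d ↔ g.HasQuotientLimit F (g.quotSet a b t) t d := by
  by_cases hD : t ∈ g.D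
  · have : g.quotSet a b t = Ioc t b := by
      ext s
      simp only [quotSet, hD, forall_const, mem_ofPred_eq, mem_Ioc, mem_Icc]
      refine ⟨fun h => ⟨h.2.2, h.1.2⟩, fun h => ⟨⟨ht.1.trans h.1.le, h.2⟩, ?_, h.1⟩⟩
      have h1 := g.jump_le h.1
      have h2 : 0 < g.jump t := hD
      intro h3
      linarith
    simp [HasGDerivAt, ht, hC, hD, this]
  · have : g.quotSet a b t = {s | s ∈ Icc a b ∧ g s ≠ g t} := by
      ext s; simp [quotSet, hD]
    simp [HasGDerivAt, ht, hC, hD, this]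

theorem tendsto_sub_quotSet (g : Derivator) (a b t : ℝ) :
    Tendsto (fun s => g s - g t) (𝓝[g.quotSet a b t] t) (𝓝 (g.jump t)) := by
  by_cases hD : t ∈ g.D
  · exact (g.tendsto_sub_nhdsGT t).mono_left (nhdsWithin_mono _ fun s hs => hs.2.2 hD)
  · have := ((g.continuousAt hD).tendsto.mono_left
      (nhdsWithin_le_nhds (s := g.quotSet a b t))).sub_const (g t)
    rwa [sub_self, ← g.jump_eq_zero hD] at this

/-- The condition at `a` is needed: `g` may vary only to the left of `a`, leaving no quotient near
`a` inside the interval. This exception has measure zero. -/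
theorem neBot_quotSet (g : Derivator) {a b t : ℝ} (hC : t ∉ g.C) (ht : t ∈ Ico a b)
    (ha : t = a → t ∈ g.D) : (𝓝[g.quotSet a b t] t).NeBot := by
  by_cases hD : t ∈ g.D
  · have : Ioc t b ⊆ g.quotSet a b t := fun s hs =>
      ⟨⟨ht.1.trans hs.1.le, hs.2⟩, fun h => by
        have h1 := g.jump_le hs.1
        have h2 : 0 < g.jump t := hD
        linarith, fun _ => hs.1⟩
    have h2 : (𝓝[Ioc t b] t).NeBot := by
      rw [nhdsWithin_Ioc_eq_nhdsGT ht.2]; infer_instance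
    exact h2.mono (nhdsWithin_mono _ this)
  · have hat : a < t := lt_of_le_of_ne ht.1 fun h => hD (ha h.symm)
    rw [← mem_closure_iff_nhdsWithin_neBot, Metric.mem_closure_iff]
    intro ε hε
    have hC' : ¬ ∃ ε > 0, ∀ s ∈ Ioo (t - ε) (t + ε), g s = g t := hC
    push Not at hC'
    obtain ⟨s, hs, hst⟩ := hC' (min ε (min (t - a) (b - t)))
      (lt_min hε (lt_min (by linarith) (by linarith [ht.2])))
    have h1 := min_le_left ε (min (t - a) (b - t))
    have h2 := (min_le_right ε (min (t - a) (b - t))).trans (min_le_left _ _)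
    have h3 := (min_le_right ε (min (t - a) (b - t))).trans (min_le_right _ _)
    refine ⟨s, ⟨⟨by linarith [hs.1], by linarith [hs.2]⟩, hst, fun h => absurd h hD⟩, ?_⟩
    rw [Real.dist_eq, abs_lt]
    exact ⟨by linarith [hs.2], by linarith [hs.1]⟩

/-! ### Calculus rules for the `g`-derivative. -/

section Quotient

variable {g : Derivator} {F G : ℝ → 𝕜} {a b t : ℝ} {c d : 𝕜}

theorem HasQuotientLimit.tendsto (h : g.HasQuotientLimit F (g.quotSet a b t) t d) :
    Tendsto F (𝓝[g.quotSet a b t] t) (𝓝 (F t + d * (g.jump t : 𝕜))) := by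
  have h1 : Tendsto (fun s => ((g s - g t : ℝ) : 𝕜)) (𝓝[g.quotSet a b t] t)
      (𝓝 (g.jump t : 𝕜)) :=
    (RCLike.continuous_ofReal.tendsto _).comp (g.tendsto_sub_quotSet a b t)
  refine ((h.2.mul h1).const_add (F t)).congr' ?_
  filter_upwards [self_mem_nhdsWithin] with s hs
  have : ((g s - g t : ℝ) : 𝕜) ≠ 0 := by
    exact_mod_cast sub_ne_zero.2 hs.2.1
  rw [div_mul_cancel₀ _ this]
  ring

theorem HasQuotientLimit.congr (h : g.HasQuotientLimit F (g.quotSet a b t) t d)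
    (hFG : EqOn F G (Icc a b)) (ht : t ∈ Icc a b) :
    g.HasQuotientLimit G (g.quotSet a b t) t d := by
  refine ⟨h.1, h.2.congr' ?_⟩
  filter_upwards [self_mem_nhdsWithin] with s hs
  rw [hFG hs.1, hFG ht]

theorem HasQuotientLimit.sub (hF : g.HasQuotientLimit F (g.quotSet a b t) t c)
    (hG : g.HasQuotientLimit G (g.quotSet a b t) t d) :
    g.HasQuotientLimit (fun s => F s - G s) (g.quotSet a b t) t (c - d) := by
  refine ⟨hF.1, (hF.2.sub hG.2).congr fun s => ?_⟩
  ring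

/-- The second factor enters through its limit along `quotSet`, which differs from `G t` at a jump;
this is the source of the factor 1 + βΔ. -/
theorem HasQuotientLimit.mul (hF : g.HasQuotientLimit F (g.quotSet a b t) t c)
    (hG : g.HasQuotientLimit G (g.quotSet a b t) t d) :
    g.HasQuotientLimit (fun s => F s * G s) (g.quotSet a b t) t
      (c * (G t + d * (g.jump t : 𝕜)) + F t * d) := by
  refine ⟨hF.1, ((hF.2.mul hG.tendsto).add (hG.2.const_mul (F t))).congr fun s => ?_⟩
  ring

/-- The quotient of φ ∘ F is `dslope φ (F t) (F s)` times that of F. Continuity of `dslope` at the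
limit of F is differentiability of φ if that limit is `F t`, and continuity of φ otherwise. -/
theorem HasQuotientLimit.comp_differentiableAt {φ : 𝕜 → 𝕜}
    (hF : g.HasQuotientLimit F (g.quotSet a b t) t d) (hφ : DifferentiableAt 𝕜 φ (F t))
    (hφ' : ContinuousAt φ (F t + d * (g.jump t : 𝕜))) :
    g.HasQuotientLimit (fun s => φ (F s)) (g.quotSet a b t) t
      (dslope φ (F t) (F t + d * (g.jump t : 𝕜)) * d) := by
  have h1 : ContinuousAt (dslope φ (F t)) (F t + d * (g.jump t : 𝕜)) := by
    by_cases h : F t + d * (g.jump t : 𝕜) = F t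
    · rw [h]
      exact continuousAt_dslope_same.2 hφ
    · exact (continuousAt_dslope_of_ne h).2 hφ'
  refine ⟨hF.1, ((h1.tendsto.comp hF.tendsto).mul hF.2).congr fun s => ?_⟩
  rw [← sub_smul_dslope φ (F t) (F s), smul_eq_mul, Function.comp]
  ring

theorem HasQuotientLimit.map {𝕜' : Type*} [RCLike 𝕜']
    (hF : g.HasQuotientLimit F (g.quotSet a b t) t d) (L : 𝕜 →L[ℝ] 𝕜') :
    g.HasQuotientLimit (fun s => L (F s)) (g.quotSet a b t) t (L d) := by
  refine ⟨hF.1, ((L.continuous.tendsto _).comp hF.2).congr fun s => ?_⟩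
  have h1 : (F s - F t) / ((g s - g t : ℝ) : 𝕜) = (g s - g t)⁻¹ • (F s - F t) := by
    rw [RCLike.real_smul_eq_coe_mul, RCLike.ofReal_inv, div_eq_inv_mul]
  rw [Function.comp, h1, map_smul, map_sub, RCLike.real_smul_eq_coe_mul, RCLike.ofReal_inv,
    div_eq_inv_mul]

end Quotient

/-! ### `g`-absolutely continuous functions. -/

section AbsCont

variable {g : Derivator} {F : ℝ → 𝕜} {a b : ℝ}

theorem AbsCont.exists_forall_norm_sub_lt (h : g.AbsCont a b F) {ε : ℝ} (hε : 0 < ε) :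
    ∃ δ > 0, ∀ p q, a ≤ p → p ≤ q → q ≤ b → g q - g p < δ → ‖F q - F p‖ < ε := by
  obtain ⟨δ, hδ, H⟩ := h ε hε
  refine ⟨δ, hδ, fun p q hp hpq hq hg => ?_⟩
  rcases hpq.eq_or_lt with rfl | hpq
  · simpa using hε
  · simpa using H 1 (fun _ => p) (fun _ => q) (fun _ => ⟨hp, hpq, hq⟩)
      (fun i j hij => absurd (Subsingleton.elim i j) hij) (by simpa using hg)

theorem AbsCont.eq_of_apply_eq (h : g.AbsCont a b F) {p q : ℝ} (hp : a ≤ p) (hpq : p ≤ q)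
    (hq : q ≤ b) (hg : g q = g p) : F q = F p := by
  refine sub_eq_zero.1 (norm_le_zero_iff.1 (le_of_forall_pos_le_add fun ε hε => ?_))
  obtain ⟨δ, hδ, H⟩ := h.exists_forall_norm_sub_lt hε
  rw [zero_add]
  exact (H p q hp hpq hq (by rw [hg, sub_self]; exact hδ)).le

theorem AbsCont.mono_right (h : g.AbsCont a b F) {c : ℝ} (hc : c ≤ b) : g.AbsCont a c F :=
  fun ε hε =>
    let ⟨δ, hδ, H⟩ := h ε hε
    ⟨δ, hδ, fun n p q hpq => H n p q fun i => ⟨(hpq i).1, (hpq i).2.1, (hpq i).2.2.trans hc⟩⟩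

theorem exists_lt_forall_sub_lt (g : Derivator) (t : ℝ) {δ : ℝ} (hδ : 0 < δ) :
    ∃ l < t, ∀ s, l < s → g t - g s < δ := by
  have h1 : Tendsto g (𝓝[<] t) (𝓝 (g t)) := (g.leftContinuous' t).mono Iio_subset_Iic_self
  have h2 := h1.eventually (lt_mem_nhds (sub_lt_self (g t) hδ))
  obtain ⟨l, hl, H⟩ := (mem_nhdsLT_iff_exists_Ioo_subset).1 h2
  refine ⟨l, hl, fun s hs => ?_⟩
  rcases lt_or_ge s t with hst | hst
  · have : g t - δ < g s := H ⟨hs, hst⟩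
    linarith
  · linarith [g.mono hst]

/-- Compactness reduces this to local bounds. To the left of x, F is compared with F(x); to the
right a jump forbids this, but `g` oscillates little on a short open interval after x, so a point c
of that interval serves instead. -/
theorem AbsCont.exists_forall_norm_le (h : g.AbsCont a b F) :
    ∃ M, ∀ t ∈ Icc a b, ‖F t‖ ≤ M := by
  obtain ⟨δ, hδ, H⟩ := h.exists_forall_norm_sub_lt one_pos
  have key := isCompact_Icc.induction_on (s := Icc a b)
    (p := fun s => ∃ M, ∀ t ∈ s ∩ Icc a b, ‖F t‖ ≤ M) ⟨0, by simp⟩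
    (fun s t hst ⟨M, hM⟩ => ⟨M, fun x hx => hM x ⟨hst hx.1, hx.2⟩⟩)
    (fun s t ⟨M, hM⟩ ⟨M', hM'⟩ => ⟨max M M', fun x hx => hx.1.elim
      (fun h1 => (hM x ⟨h1, hx.2⟩).trans (le_max_left _ _))
      (fun h1 => (hM' x ⟨h1, hx.2⟩).trans (le_max_right _ _))⟩) ?_
  · obtain ⟨M, hM⟩ := key
    exact ⟨M, fun t ht => hM t ⟨ht, ht⟩⟩
  intro x hx
  obtain ⟨l, hl, Hl⟩ := g.exists_lt_forall_sub_lt x hδ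
  obtain ⟨u, hu, Hu⟩ := (mem_nhdsGT_iff_exists_Ioo_subset).1
    ((g.tendsto_sub_nhdsGT x).eventually (gt_mem_nhds (lt_add_of_pos_right (g.jump x) hδ)))
  have hosc : ∀ s ∈ Ioo x u, ∀ r ∈ Ioo x u, g s - g r < δ := by
    intro s hs r hr
    have h1 : g s - g x < g.jump x + δ := Hu hs
    linarith [g.jump_le hr.1]
  obtain ⟨c, hc⟩ : ∃ c, ∀ s ∈ Ioo x u ∩ Icc a b, ‖F s - F c‖ ≤ 1 := by
    by_cases hne : (Ioo x u ∩ Icc a b).Nonempty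
    · obtain ⟨c, hc⟩ := hne
      refine ⟨c, fun s hs => ?_⟩
      rcases le_total s c with hsc | hsc
      · rw [norm_sub_rev]
        exact (H s c hs.2.1 hsc hc.2.2 (hosc _ hc.1 _ hs.1)).le
      · exact (H c s hc.2.1 hsc hs.2.2 (hosc _ hs.1 _ hc.1)).le
    · exact ⟨0, fun s hs => absurd ⟨s, hs⟩ hne⟩
  refine ⟨Ioo l u, mem_nhdsWithin_of_mem_nhds (Ioo_mem_nhds hl hu),
    1 + ‖F x‖ + ‖F c‖, fun s hs => ?_⟩
  rcases le_or_gt s x with hsx | hsx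
  · have h1 := (H s x hs.2.1 hsx hx.2 (Hl s hs.1.1)).le
    have h2 := norm_sub_norm_le (F s) (F x)
    rw [norm_sub_rev] at h1
    linarith [norm_nonneg (F c)]
  · have h1 := hc s ⟨⟨hsx, hs.1.2⟩, hs.2⟩
    have h2 := norm_sub_norm_le (F s) (F c)
    linarith [norm_nonneg (F x)]

/-- Common source of the closure properties. The fields may differ because E, valued in `𝕜`, is
compared with a complex primitive. -/
theorem AbsCont.of_norm_sub_le {𝕜₁ 𝕜₂ : Type*} [RCLike 𝕜₁] [RCLike 𝕜₂] {F₁ : ℝ → 𝕜₁}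
    {F₂ : ℝ → 𝕜₂} (h₁ : g.AbsCont a b F₁) (h₂ : g.AbsCont a b F₂) (K : ℝ)
    (h : ∀ p ∈ Icc a b, ∀ q ∈ Icc a b, ‖F q - F p‖ ≤ K * (‖F₁ q - F₁ p‖ + ‖F₂ q - F₂ p‖)) :
    g.AbsCont a b F := by
  intro ε hε
  have hK : 0 < max K 1 := lt_max_of_lt_right one_pos
  obtain ⟨δ₁, hδ₁, H₁⟩ := h₁ (ε / (2 * max K 1)) (by positivity)
  obtain ⟨δ₂, hδ₂, H₂⟩ := h₂ (ε / (2 * max K 1)) (by positivity)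
  refine ⟨min δ₁ δ₂, lt_min hδ₁ hδ₂, fun n p q hpq hd hs => ?_⟩
  have e1 := H₁ n p q hpq hd (hs.trans_le (min_le_left _ _))
  have e2 := H₂ n p q hpq hd (hs.trans_le (min_le_right _ _))
  calc ∑ i, ‖F (q i) - F (p i)‖
      ≤ ∑ i, max K 1 * (‖F₁ (q i) - F₁ (p i)‖ + ‖F₂ (q i) - F₂ (p i)‖) := by
        refine Finset.sum_le_sum fun i _ => ?_
        obtain ⟨h1, h2, h3⟩ := hpq i
        exact (h _ ⟨h1, h2.le.trans h3⟩ _ ⟨h1.trans h2.le, h3⟩).trans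
          (mul_le_mul_of_nonneg_right (le_max_left _ _) (by positivity))
    _ = max K 1 * (∑ i, ‖F₁ (q i) - F₁ (p i)‖ + ∑ i, ‖F₂ (q i) - F₂ (p i)‖) := by
        rw [← Finset.mul_sum, Finset.sum_add_distrib]
    _ < max K 1 * (ε / (2 * max K 1) + ε / (2 * max K 1)) :=
        mul_lt_mul_of_pos_left (add_lt_add e1 e2) hK
    _ = ε := by field_simp; ring

variable {G : ℝ → 𝕜}

theorem AbsCont.congr (h : g.AbsCont a b F) (hFG : EqOn F G (Icc a b)) : g.AbsCont a b G :=
  h.of_norm_sub_le h 1 fun p hp q hq => by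
    rw [← hFG hp, ← hFG hq]
    linarith [norm_nonneg (F q - F p)]

theorem AbsCont.sub (hF : g.AbsCont a b F) (hG : g.AbsCont a b G) :
    g.AbsCont a b fun t => F t - G t :=
  hF.of_norm_sub_le hG 1 fun p _ q _ => by
    rw [one_mul]
    calc ‖F q - G q - (F p - G p)‖ = ‖(F q - F p) - (G q - G p)‖ := by congr 1; ring
      _ ≤ _ := norm_sub_le _ _

theorem AbsCont.const_add (hF : g.AbsCont a b F) (c : 𝕜) : g.AbsCont a b fun t => c + F t :=
  hF.of_norm_sub_le hF 1 fun p _ q _ => by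
    rw [add_sub_add_left_eq_sub]
    linarith [norm_nonneg (F q - F p)]

theorem AbsCont.mul (hF : g.AbsCont a b F) (hG : g.AbsCont a b G) :
    g.AbsCont a b fun t => F t * G t := by
  obtain ⟨M, hM⟩ := hF.exists_forall_norm_le
  obtain ⟨M', hM'⟩ := hG.exists_forall_norm_le
  refine hF.of_norm_sub_le hG (max M M') fun p hp q hq => ?_
  calc ‖F q * G q - F p * G p‖ = ‖(F q - F p) * G q + F p * (G q - G p)‖ := by congr 1; ring
    _ ≤ ‖F q - F p‖ * ‖G q‖ + ‖F p‖ * ‖G q - G p‖ := by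
        refine (norm_add_le _ _).trans ?_
        rw [norm_mul, norm_mul]
    _ ≤ ‖F q - F p‖ * max M M' + max M M' * ‖G q - G p‖ := by
        gcongr
        · exact (hM' q hq).trans (le_max_right _ _)
        · exact (hM p hp).trans (le_max_left _ _)
    _ = _ := by ring

/-- A uniform lower bound is assumed because F may jump: a nonvanishing F can still have right limit
zero. -/
theorem AbsCont.inv (hF : g.AbsCont a b F) {c : ℝ} (hc : 0 < c)
    (h : ∀ t ∈ Icc a b, c ≤ ‖F t‖) : g.AbsCont a b fun t => (F t)⁻¹ := by
  refine hF.of_norm_sub_le hF (c⁻¹ * c⁻¹) fun p hp q hq => ?_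
  have hp0 : F p ≠ 0 := norm_pos_iff.1 (hc.trans_le (h p hp))
  have hq0 : F q ≠ 0 := norm_pos_iff.1 (hc.trans_le (h q hq))
  have h1 : (F q)⁻¹ - (F p)⁻¹ = (F q)⁻¹ * (F p)⁻¹ * (F p - F q) := by
    field_simp
  rw [h1, norm_mul, norm_mul, norm_inv, norm_inv, norm_sub_rev (F p)]
  have h2 : ‖F q‖⁻¹ ≤ c⁻¹ := inv_anti₀ hc (h q hq)
  have h3 : ‖F p‖⁻¹ ≤ c⁻¹ := inv_anti₀ hc (h p hp)
  gcongr
  linarith [norm_nonneg (F q - F p)]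

end AbsCont

/-! ### Indefinite integrals are `g`-absolutely continuous. -/

section Primitive

variable {g : Derivator} {h : ℝ → 𝕜} {a b : ℝ}

theorem setIntegral_Ico_sub (hh : IntegrableOn h (Ico a b) g.measure) {p q : ℝ} (hp : a ≤ p)
    (hpq : p ≤ q) (hq : q ≤ b) :
    ∫ s in Ico a q, h s ∂g.measure - ∫ s in Ico a p, h s ∂g.measure
      = ∫ s in Ico p q, h s ∂g.measure := by
  rw [← Ico_union_Ico_eq_Ico hp hpq, setIntegral_union
    (disjoint_left.2 fun x hx hx' => absurd hx.2 (not_lt.2 hx'.1)) measurableSet_Ico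
    (hh.mono_set (Ico_subset_Ico_right (hpq.trans hq)))
    (hh.mono_set (Ico_subset_Ico hp hq))]
  ring

/-- Bridges the open intervals of `AbsCont` and the half-open ones whose measure is the increment of
`g`. -/
theorem measure_iUnion_Ico {n : ℕ} {p q : Fin n → ℝ} (hpq : ∀ i, p i < q i)
    (hd : Pairwise fun i j => Disjoint (Ioo (p i) (q i)) (Ioo (p j) (q j))) :
    Pairwise (fun i j => Disjoint (Ico (p i) (q i)) (Ico (p j) (q j))) ∧
    g.measure (⋃ i, Ico (p i) (q i)) = ENNReal.ofReal (∑ i, (g (q i) - g (p i))) := by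
  have hd' : Pairwise fun i j => Disjoint (Ico (p i) (q i)) (Ico (p j) (q j)) :=
    fun i j hij => Ico_disjoint_Ico.2 (Ioo_disjoint_Ioo.1 (hd hij))
  refine ⟨hd', ?_⟩
  rw [measure_iUnion hd' fun _ => measurableSet_Ico, tsum_fintype,
    ENNReal.ofReal_sum_of_nonneg fun i _ => sub_nonneg.2 (g.mono (hpq i).le)]
  simp_rw [g.measure_Ico]

theorem absCont_setIntegral (hh : IntegrableOn h (Ico a b) g.measure) :
    g.AbsCont a b fun t => ∫ s in Ico a t, h s ∂g.measure := by
  intro ε hε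
  obtain ⟨δ, hδ, H⟩ := exists_pos_setLIntegral_lt_of_measure_lt
    (μ := g.measure.restrict (Ico a b)) (f := fun s => ‖h s‖ₑ) hh.2.ne
    (ε := ENNReal.ofReal ε) (by simpa using hε)
  obtain ⟨δ', hδ', hlt⟩ : ∃ δ' : ℝ, 0 < δ' ∧ ENNReal.ofReal δ' ≤ δ := by
    rcases eq_or_ne δ ⊤ with rfl | h
    · exact ⟨1, one_pos, le_top⟩
    · exact ⟨δ.toReal, ENNReal.toReal_pos hδ.ne' h, (ENNReal.ofReal_toReal h).le⟩
  refine ⟨δ', hδ', fun n p q hpq hd hs => ?_⟩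
  obtain ⟨hd', hm⟩ := g.measure_iUnion_Ico (fun i => (hpq i).2.1) hd
  have hsub : ∀ i, Ico (p i) (q i) ⊆ Ico a b := fun i => Ico_subset_Ico (hpq i).1 (hpq i).2.2
  have h1 : g.measure.restrict (Ico a b) (⋃ i, Ico (p i) (q i)) < δ :=
    (Measure.restrict_apply_le _ _).trans_lt
      (hm ▸ ((ENNReal.ofReal_lt_ofReal_iff hδ').2 hs).trans_le hlt)
  have h2 := H _ h1
  rw [← ENNReal.ofReal_lt_ofReal_iff hε, ENNReal.ofReal_sum_of_nonneg fun i _ => norm_nonneg _]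
  refine lt_of_le_of_lt ?_ h2
  rw [lintegral_iUnion (fun _ => measurableSet_Ico) hd', tsum_fintype]
  refine Finset.sum_le_sum fun i _ => ?_
  rw [setIntegral_Ico_sub hh (hpq i).1 (hpq i).2.1.le (hpq i).2.2, ofReal_norm,
    Measure.restrict_restrict measurableSet_Ico, inter_eq_left.2 (hsub i)]
  exact enorm_integral_le_lintegral_enorm _

end Primitive

/-! ### Zero derivative almost everywhere implies constancy. -/

section Variation

variable {g : Derivator} {Z : ℝ → 𝕜} {a b : ℝ}

/-- The sums of increments of `Z` over finite families of intervals of `[a,x]` lying in `U`. -/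
def incrementSums (Z : ℝ → 𝕜) (U : Set ℝ) (a x : ℝ) : Set ℝ :=
  {r | ∃ (n : ℕ) (p q : Fin n → ℝ), (∀ i, a ≤ p i ∧ p i < q i ∧ q i ≤ x) ∧
    (Pairwise fun i j => Disjoint (Ioo (p i) (q i)) (Ioo (p j) (q j))) ∧
    (∀ i, Ico (p i) (q i) ⊆ U) ∧ r = ∑ i, ‖Z (q i) - Z (p i)‖}

theorem zero_mem_incrementSums (Z : ℝ → 𝕜) (U : Set ℝ) (a x : ℝ) :
    0 ∈ incrementSums Z U a x :=
  ⟨0, Fin.elim0, Fin.elim0, fun i => i.elim0, fun i => i.elim0, fun i => i.elim0, by simp⟩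

theorem incrementSums_mono {U : Set ℝ} {x y : ℝ} (hxy : x ≤ y) :
    incrementSums Z U a x ⊆ incrementSums Z U a y := by
  rintro r ⟨n, p, q, h1, h2⟩
  exact ⟨n, p, q, fun i => ⟨(h1 i).1, (h1 i).2.1, (h1 i).2.2.trans hxy⟩, h2⟩

/-- Appending the interval from x to y to a family shows that the supremum of these sums grows by at
least the increment of Z. -/
theorem add_mem_incrementSums {U : Set ℝ} {x y r : ℝ} (hax : a ≤ x) (hxy : x < y)
    (hU : Ico x y ⊆ U) (hr : r ∈ incrementSums Z U a x) :
    r + ‖Z y - Z x‖ ∈ incrementSums Z U a y := by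
  obtain ⟨n, p, q, h1, h2, h3, rfl⟩ := hr
  have hd : ∀ i, Disjoint (Ioo (p i) (q i)) (Ioo x y) := fun i =>
    disjoint_left.2 fun z hz hz' => absurd (hz.2.trans_le (h1 i).2.2) (not_lt.2 hz'.1.le)
  refine ⟨n + 1, Fin.snoc (α := fun _ => ℝ) p x, Fin.snoc (α := fun _ => ℝ) q y, ?_, ?_, ?_, ?_⟩
  · intro i
    refine Fin.lastCases ?_ (fun i => ?_) i
    · simpa using ⟨hax, hxy⟩
    · simpa using ⟨(h1 i).1, (h1 i).2.1, (h1 i).2.2.trans hxy.le⟩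
  · intro i j
    refine Fin.lastCases ?_ (fun i => ?_) i <;> refine Fin.lastCases ?_ (fun j => ?_) j
    · intro h; exact absurd rfl h
    · intro _; simpa using (hd j).symm
    · intro _; simpa using hd i
    · intro h
      simpa using h2 (fun e => h (by rw [e]))
  · intro i
    refine Fin.lastCases ?_ (fun i => ?_) i
    · simpa using hU
    · simpa using h3 i
  · simp [Fin.sum_univ_castSucc]

theorem incrementSums_le {U : Set ℝ} {ε δ x : ℝ} (hδ : 0 < δ) (hx : x ≤ b)
    (hU : g.measure U < ENNReal.ofReal δ)
    (H : ∀ (n : ℕ) (p q : Fin n → ℝ), (∀ i, a ≤ p i ∧ p i < q i ∧ q i ≤ b) →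
      (Pairwise fun i j => Disjoint (Ioo (p i) (q i)) (Ioo (p j) (q j))) →
      ∑ i, (g (q i) - g (p i)) < δ → ∑ i, ‖Z (q i) - Z (p i)‖ < ε) :
    ∀ r ∈ incrementSums Z U a x, r ≤ ε := by
  rintro r ⟨n, p, q, h1, h2, h3, rfl⟩
  refine (H n p q (fun i => ⟨(h1 i).1, (h1 i).2.1, (h1 i).2.2.trans hx⟩) h2 ?_).le
  rw [← ENNReal.ofReal_lt_ofReal_iff hδ, ← (g.measure_iUnion_Ico (fun i => (h1 i).2.1) h2).2]
  exact (measure_mono (iUnion_subset h3)).trans_lt hU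

/-- Continuous induction along an interval. -/
theorem forall_mem_Icc_of_step {P : ℝ → Prop} (ha : P a)
    (hleft : ∀ c ∈ Ioc a b, (∀ y ∈ Ico a c, P y) → P c)
    (hright : ∀ c ∈ Ico a b, P c → ∃ u > c, ∀ s ∈ Ioo c u, s ≤ b → P s) :
    ∀ x ∈ Icc a b, P x := by
  intro x hx
  have hab := hx.1.trans hx.2
  set S := {x | x ∈ Icc a b ∧ ∀ y ∈ Icc a x, P y} with hS
  have haS : a ∈ S := ⟨⟨le_rfl, hab⟩, fun y hy => by rwa [le_antisymm hy.2 hy.1]⟩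
  have hbdd : BddAbove S := ⟨b, fun y hy => hy.1.2⟩
  have hac : a ≤ sSup S := le_csSup hbdd haS
  have hcb : sSup S ≤ b := csSup_le ⟨a, haS⟩ fun y hy => hy.1.2
  have hlt : ∀ y ∈ Ico a (sSup S), P y := fun y hy => by
    obtain ⟨z, hz, hyz⟩ := exists_lt_of_lt_csSup ⟨a, haS⟩ hy.2
    exact hz.2 y ⟨hy.1, hyz.le⟩
  have hc : P (sSup S) := by
    rcases hac.eq_or_lt with h | h
    · rwa [← h]
    · exact hleft _ ⟨h, hcb⟩ hlt
  have hle : ∀ y ∈ Icc a (sSup S), P y := fun y hy => by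
    rcases hy.2.eq_or_lt with h | h
    · rwa [h]
    · exact hlt y ⟨hy.1, h⟩
  rcases hcb.eq_or_lt with h | h
  · exact hle x ⟨hx.1, hx.2.trans h.ge⟩
  exfalso
  obtain ⟨u, hu, H⟩ := hright _ ⟨hac, h⟩ hc
  -- A point beyond the supremum that still belongs to `S`.
  obtain ⟨v, hv, hv'⟩ := exists_between (lt_min hu h)
  have : v ∈ S := by
    refine ⟨⟨hac.trans hv.le, (hv'.trans_le (min_le_right _ _)).le⟩, fun y hy => ?_⟩
    rcases le_or_gt y (sSup S) with h1 | h1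
    · exact hle y ⟨hy.1, h1⟩
    · exact H y ⟨h1, hy.2.trans_lt (hv'.trans_le (min_le_left _ _))⟩
        (hy.2.trans (hv'.trans_le (min_le_right _ _)).le)
  exact absurd (le_csSup hbdd this) (not_le.2 hv)

/-- Where `g s ≠ g c` the small quotient gives the bound; where `g s = g c` absolute continuity
forces `Z s = Z c`. -/
theorem AbsCont.exists_forall_norm_sub_le_mul (hZ : g.AbsCont a b Z) {c ε : ℝ} (hε : 0 < ε)
    (hc : c ∈ Ico a b) (h : c ∉ g.C → g.HasQuotientLimit Z (g.quotSet a b c) c 0) :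
    ∃ u > c, ∀ s ∈ Ioo c u, s ≤ b → ‖Z s - Z c‖ ≤ ε * (g s - g c) := by
  have hconst : ∀ s, c < s → s ≤ b → g s = g c → ‖Z s - Z c‖ ≤ ε * (g s - g c) :=
    fun s h1 h2 h3 => by rw [hZ.eq_of_apply_eq hc.1 h1.le h2 h3, h3]; simp
  by_cases hC : c ∈ g.C
  · obtain ⟨η, hη, H⟩ := hC
    exact ⟨c + η, by linarith, fun s hs hsb =>
      hconst s hs.1 hsb (H s ⟨by linarith [hs.1], hs.2⟩)⟩
  · have h1 := (h hC).2.norm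
    rw [norm_zero] at h1
    have h2 := h1.eventually (gt_mem_nhds hε)
    rw [eventually_nhdsWithin_iff, Metric.eventually_nhds_iff] at h2
    obtain ⟨η, hη, H⟩ := h2
    refine ⟨c + η, by linarith, fun s hs hsb => ?_⟩
    rcases eq_or_ne (g s) (g c) with he | he
    · exact hconst s hs.1 hsb he
    have hpos : 0 < g s - g c :=
      sub_pos.2 (lt_of_le_of_ne (g.mono hs.1.le) (Ne.symm he))
    have h3 := H (y := s) (by rw [Real.dist_eq, abs_lt]; constructor <;> linarith [hs.1, hs.2])
      ⟨⟨hc.1.trans hs.1.le, hsb⟩, he, fun _ => hs.1⟩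
    rw [norm_div, RCLike.norm_ofReal, abs_of_pos hpos, div_lt_iff₀ hpos] at h3
    exact h3.le

/-- A `g`-absolutely continuous function whose `g`-derivative vanishes almost everywhere is
constant. -/
theorem AbsCont.eq_of_hasQuotientLimit_zero (hZ : g.AbsCont a b Z)
    (h : ∀ᵐ t ∂(g.measure.restrict (Ico a b)),
      t ∉ g.C → g.HasQuotientLimit Z (g.quotSet a b t) t 0) :
    ∀ x ∈ Icc a b, Z x = Z a := by
  -- The exceptional null set N is covered by an open U with measure below δ. The variation V of Z
  -- inside U is then at most ε, and continuous induction gives the bound with V(x) as the last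
  -- term.
  have main : ∀ ε > 0, ∀ x ∈ Icc a b, ‖Z x - Z a‖ ≤ ε * (g x - g a) + ε := by
    intro ε hε
    obtain ⟨δ, hδ, H⟩ := hZ ε hε
    set N := {t | ¬(t ∈ Ico a b → t ∉ g.C → g.HasQuotientLimit Z (g.quotSet a b t) t 0)} with hN
    have hN0 : g.measure N = 0 := (ae_restrict_iff' measurableSet_Ico).1 h
    obtain ⟨U, hNU, hUo, hU⟩ := N.exists_isOpen_lt_of_lt (μ := g.measure) (ENNReal.ofReal δ)
      (by rw [hN0]; exact ENNReal.ofReal_pos.2 hδ)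
    have hle : ∀ x, x ≤ b → ∀ r ∈ incrementSums Z U a x, r ≤ ε := fun x hx =>
      incrementSums_le hδ hx hU H
    set V : ℝ → ℝ := fun x => sSup (incrementSums Z U a x) with hV
    have hV0 : ∀ x, x ≤ b → 0 ≤ V x := fun x hx =>
      le_csSup ⟨ε, hle x hx⟩ (zero_mem_incrementSums _ _ _ _)
    have hVm : ∀ x y, x ≤ y → y ≤ b → V x ≤ V y := fun x y hxy hy =>
      csSup_le_csSup ⟨ε, hle y hy⟩ ⟨0, zero_mem_incrementSums _ _ _ _⟩ (incrementSums_mono hxy)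
    have hVε : ∀ x, x ≤ b → V x ≤ ε := fun x hx =>
      csSup_le ⟨0, zero_mem_incrementSums _ _ _ _⟩ (hle x hx)
    have claim : ∀ x ∈ Icc a b, ‖Z x - Z a‖ ≤ ε * (g x - g a) + V x := by
      intro x hx
      have hab := hx.1.trans hx.2
      refine forall_mem_Icc_of_step (P := fun x => ‖Z x - Z a‖ ≤ ε * (g x - g a) + V x)
        (by simpa using hV0 a hab) ?_ ?_ x hx
      -- Limit step: Z changes by less than η from some y < c, by left-continuity of `g`, while the
      -- right-hand side is monotone.
      · intro c hc hlt
        refine le_of_forall_pos_le_add fun η hη => ?_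
        obtain ⟨δ', hδ', H'⟩ := hZ.exists_forall_norm_sub_lt hη
        obtain ⟨l, hl, Hl⟩ := g.exists_lt_forall_sub_lt c hδ'
        obtain ⟨y, hy, hyc⟩ := exists_between (max_lt hl hc.1)
        have hay := ((le_max_right l a).trans_lt hy).le
        have h1 := H' y c hay hyc.le hc.2 (Hl y ((le_max_left l a).trans_lt hy))
        have h2 := hlt y ⟨hay, hyc⟩
        have h3 := hVm y c hyc.le hc.2
        have h4 := mul_le_mul_of_nonneg_left (g.mono hyc.le) hε.le
        have h5 := norm_sub_le_norm_sub_add_norm_sub (Z c) (Z y) (Z a)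
        linarith
      · intro c hc hPc
        suffices ∃ u > c, ∀ s ∈ Ioo c u, s ≤ b →
            ‖Z s - Z c‖ ≤ ε * (g s - g c) + (V s - V c) by
          obtain ⟨u, hu, Hu⟩ := this
          refine ⟨u, hu, fun s hs hsb => ?_⟩
          have h1 := Hu s hs hsb
          have h2 := norm_sub_le_norm_sub_add_norm_sub (Z s) (Z c) (Z a)
          linarith
        -- Inside U the growth of V absorbs the increment of Z; outside U the derivative at c
        -- vanishes unless c ∈ `C`, where Z is locally constant to the right.
        by_cases hcU : c ∈ U
        · obtain ⟨u, hu, Hu⟩ := exists_Ico_subset_of_mem_nhds (hUo.mem_nhds hcU) (exists_gt c)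
          refine ⟨u, hu, fun s hs hsb => ?_⟩
          have h1 : V c ≤ V s - ‖Z s - Z c‖ := by
            refine csSup_le ⟨0, zero_mem_incrementSums _ _ _ _⟩ fun r hr => ?_
            have := le_csSup ⟨ε, hle s hsb⟩ (add_mem_incrementSums hc.1 hs.1
              ((Ico_subset_Ico_right hs.2.le).trans Hu) hr)
            linarith
          have h2 := mul_nonneg hε.le (sub_nonneg.2 (g.mono hs.1.le))
          linarith
        · have hcN : c ∈ Ico a b → c ∉ g.C → g.HasQuotientLimit Z (g.quotSet a b c) c 0 := by
            by_contra hn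
            exact hcU (hNU hn)
          obtain ⟨u, hu, Hu⟩ := hZ.exists_forall_norm_sub_le_mul hε hc (hcN hc)
          exact ⟨u, hu, fun s hs hsb => by
            linarith [Hu s hs hsb, hVm c s hs.1.le hsb]⟩
    exact fun x hx => (claim x hx).trans (by linarith [hVε x hx.2])
  intro x hx
  refine sub_eq_zero.1 (norm_le_zero_iff.1 (le_of_forall_pos_le_add fun η hη => ?_))
  have hg := g.mono hx.1
  have h1 := main (η / (g x - g a + 1)) (div_pos hη (by linarith)) x hx
  have h2 : η / (g x - g a + 1) * (g x - g a) + η / (g x - g a + 1) = η := by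
    have : g x - g a + 1 ≠ 0 := by linarith
    field_simp
  linarith

end Variation

/-! ### The generalized inverse carries Lebesgue measure to μ_g. -/

section PseudoInverse

variable (g : Derivator) {a b : ℝ}

/-- The generalized inverse of `g` on `[a,b]`. -/
def pseudoInv (a b y : ℝ) : ℝ := sSup {t | t ∈ Icc a b ∧ (t = a ∨ g t ≤ y)}

theorem bddAbove_pseudoInv (a b y : ℝ) : BddAbove {t | t ∈ Icc a b ∧ (t = a ∨ g t ≤ y)} :=
  ⟨b, fun _ ht => ht.1.2⟩

/-- The alternative `t = a` in the definition keeps the set nonempty for every y, so the supremum is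
never a default value. -/
theorem le_pseudoInv (hab : a ≤ b) (y : ℝ) : a ≤ g.pseudoInv a b y :=
  le_csSup (g.bddAbove_pseudoInv a b y) ⟨⟨le_rfl, hab⟩, Or.inl rfl⟩

theorem monotone_pseudoInv (hab : a ≤ b) : Monotone (g.pseudoInv a b) := fun _ _ h =>
  csSup_le_csSup (g.bddAbove_pseudoInv a b _) ⟨a, ⟨le_rfl, hab⟩, Or.inl rfl⟩
    fun _ ht => ⟨ht.1, ht.2.imp_right fun h' => h'.trans h⟩

/-- Left-continuity gives the converse: if y < g(c), then `g` already exceeds y somewhat before c.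
-/
theorem pseudoInv_lt_iff {y c : ℝ} (hab : a ≤ b) (hy : g a ≤ y) (hc : c ∈ Icc a b) :
    g.pseudoInv a b y < c ↔ y < g c := by
  constructor
  · intro h
    by_contra hn
    exact absurd (le_csSup (g.bddAbove_pseudoInv a b y) ⟨hc, Or.inr (not_lt.1 hn)⟩) (not_le.2 h)
  · intro h
    obtain ⟨l, hl, H⟩ := g.exists_lt_forall_sub_lt c (sub_pos.2 h)
    refine lt_of_le_of_lt (csSup_le ⟨a, ⟨le_rfl, hab⟩, Or.inl rfl⟩ ?_) hl
    rintro t ⟨ht, ht'⟩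
    have hty : g t ≤ y := ht'.elim (fun h => h ▸ hy) id
    by_contra hlt
    linarith [H t (not_le.1 hlt)]

theorem eq_of_pseudoInv_notMem_D {y : ℝ} (hab : a ≤ b) (hy : y ∈ Ico (g a) (g b))
    (hD : g.pseudoInv a b y ∉ g.D) : g (g.pseudoInv a b y) = y := by
  set t := g.pseudoInv a b y with ht
  have hat : a ≤ t := g.le_pseudoInv hab y
  have htb : t < b := (g.pseudoInv_lt_iff hab hy.1 ⟨hab, le_rfl⟩).2 hy.2
  refine le_antisymm (not_lt.1 fun h => ?_) ?_
  · exact lt_irrefl t ((g.pseudoInv_lt_iff hab hy.1 ⟨hat, htb.le⟩).2 h)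
  · have h1 : Tendsto g (𝓝[>] t) (𝓝 (g t)) :=
      (g.continuousAt hD).tendsto.mono_left nhdsWithin_le_nhds
    refine ge_of_tendsto h1 ?_
    filter_upwards [Ioo_mem_nhdsGT htb] with s hs
    exact ((g.pseudoInv_lt_iff hab hy.1 ⟨hat.trans hs.1.le, hs.2.le⟩).1 hs.1).le

theorem pseudoInv_preimage_Ico {c : ℝ} (hc : c ∈ Icc a b) :
    g.pseudoInv a b ⁻¹' Ico a c ∩ Ico (g a) (g b) = Ico (g a) (g c) := by
  have hab := hc.1.trans hc.2
  ext y
  simp only [mem_inter_iff, mem_preimage, mem_Ico]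
  constructor
  · rintro ⟨⟨-, h1⟩, h2, -⟩
    exact ⟨h2, (g.pseudoInv_lt_iff hab h2 hc).1 h1⟩
  · rintro ⟨h1, h2⟩
    exact ⟨⟨g.le_pseudoInv hab y, (g.pseudoInv_lt_iff hab h1 hc).2 h2⟩, h1,
      h2.trans_le (g.mono hc.2)⟩

/-- Preimages of `Ico a c` are `Ico (g a) (g c)`, so the two finite measures agree on initial
segments. A jump at t is the length of the interval collapsed to t. -/
theorem map_pseudoInv (hab : a ≤ b) :
    (volume.restrict (Ico (g a) (g b))).map (g.pseudoInv a b) = g.measure.restrict (Ico a b) := by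
  have hm := (g.monotone_pseudoInv hab).measurable
  have key : ∀ c ∈ Icc a b, (volume.restrict (Ico (g a) (g b))).map (g.pseudoInv a b) (Ico a c)
      = g.measure.restrict (Ico a b) (Ico a c) := fun c hc => by
    rw [Measure.map_apply hm measurableSet_Ico, Measure.restrict_apply (hm measurableSet_Ico),
      g.pseudoInv_preimage_Ico hc, Real.volume_Ico, Measure.restrict_apply measurableSet_Ico,
      inter_eq_left.2 (Ico_subset_Ico_right hc.2), g.measure_Ico]
  have hsupp : (volume.restrict (Ico (g a) (g b))).map (g.pseudoInv a b) (Ico a b)ᶜ = 0 := by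
    rw [Measure.map_apply hm measurableSet_Ico.compl,
      Measure.restrict_apply (hm measurableSet_Ico.compl)]
    convert measure_empty (μ := (volume : Measure ℝ))
    refine eq_empty_of_forall_notMem fun y hy => hy.1 ⟨g.le_pseudoInv hab y, ?_⟩
    exact (g.pseudoInv_lt_iff hab hy.2.1 ⟨hab, le_rfl⟩).2 hy.2.2
  have hfin : IsFiniteMeasure ((volume.restrict (Ico (g a) (g b))).map (g.pseudoInv a b)) :=
    inferInstance
  have hfin' : IsFiniteMeasure (g.measure.restrict (Ico a b)) :=
    ⟨by simp [g.measure_Ico]⟩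
  have hIio : ∀ c, (volume.restrict (Ico (g a) (g b))).map (g.pseudoInv a b) (Iio c)
      = g.measure.restrict (Ico a b) (Iio c) := by
    intro c
    -- Both measures live on `Ico a b`, so c may be clamped to [a,b].
    have h1 : ∀ ν : Measure ℝ, ν (Ico a b)ᶜ = 0 → ν (Iio c) = ν (Ico a (max a (min c b))) := by
      intro ν hν
      refine measure_congr ?_
      have h2 : ∀ᵐ x ∂ν, x ∈ Ico a b := hν
      filter_upwards [h2] with x hx
      refine propext (⟨fun h : x < c => ?_, fun h : a ≤ x ∧ x < max a (min c b) => ?_⟩)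
      · exact ⟨hx.1, lt_max_of_lt_right (lt_min h hx.2)⟩
      · rcases lt_max_iff.1 h.2 with h3 | h3
        · exact absurd h3 (not_lt.2 h.1)
        · exact (lt_min_iff.1 h3).1
    rw [h1 _ hsupp, h1 _ (by rw [Measure.restrict_apply measurableSet_Ico.compl]; simp)]
    exact key _ ⟨le_max_left _ _, max_le hab (min_le_right _ _)⟩
  refine Measure.ext_of_Ici _ _ fun c => ?_
  have huniv : (volume.restrict (Ico (g a) (g b))).map (g.pseudoInv a b) univ
      = g.measure.restrict (Ico a b) univ := by
    rw [Measure.map_apply hm MeasurableSet.univ]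
    simp [g.measure_Ico]
  rw [← compl_Iio, measure_compl measurableSet_Iio (measure_ne_top _ _),
    measure_compl measurableSet_Iio (measure_ne_top _ _), hIio, huniv]

end PseudoInverse

/-! ### Differentiation of indefinite integrals. -/

section Differentiation

variable {g : Derivator} {h : ℝ → 𝕜} {a b : ℝ}

/-- The composition of a function on `[a,b)` with the generalized inverse of `g`. -/
def pullback (g : Derivator) (a b : ℝ) (h : ℝ → 𝕜) : ℝ → 𝕜 :=
  (Ico (g a) (g b)).indicator fun y => h (g.pseudoInv a b y)

theorem integrable_pullback (hab : a ≤ b) (hh : IntegrableOn h (Ico a b) g.measure) :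
    Integrable (g.pullback a b h) := by
  rw [pullback, integrable_indicator_iff measurableSet_Ico]
  rw [IntegrableOn, ← g.map_pseudoInv hab] at hh
  exact hh.comp_measurable (g.monotone_pseudoInv hab).measurable

theorem setIntegral_eq_pullback (hh : IntegrableOn h (Ico a b) g.measure) {t : ℝ}
    (ht : t ∈ Icc a b) :
    ∫ s in Ico a t, h s ∂g.measure = ∫ y in (g a)..(g t), g.pullback a b h y := by
  have hab := ht.1.trans ht.2
  have hm := (g.monotone_pseudoInv hab).measurable
  have h1 : g.measure.restrict (Ico a t) = (g.measure.restrict (Ico a b)).restrict (Ico a t) := by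
    rw [Measure.restrict_restrict measurableSet_Ico, inter_eq_left.2 (Ico_subset_Ico_right ht.2)]
  have hh' := hh
  rw [IntegrableOn, ← g.map_pseudoInv hab] at hh'
  rw [h1, ← g.map_pseudoInv hab, setIntegral_map measurableSet_Ico hh'.1 hm.aemeasurable,
    Measure.restrict_restrict (hm measurableSet_Ico), g.pseudoInv_preimage_Ico ht,
    intervalIntegral.integral_of_le (g.mono ht.1), ← integral_Ico_eq_integral_Ioc, pullback,
    setIntegral_indicator measurableSet_Ico,
    inter_eq_left.2 (Ico_subset_Ico_right (g.mono ht.2))]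

theorem aestronglyMeasurable_setIntegral (hh : IntegrableOn h (Ico a b) g.measure) :
    AEStronglyMeasurable (fun t => ∫ s in Ico a t, h s ∂g.measure)
      (g.measure.restrict (Ico a b)) := by
  rcases le_or_gt b a with hab | hab
  · simp [Ico_eq_empty (not_lt.2 hab)]
  have hc : Continuous fun x => ∫ y in (g a)..x, g.pullback a b h y :=
    intervalIntegral.continuous_primitive
      (fun _ _ => (integrable_pullback hab.le hh).intervalIntegrable) _
  have h1 : StronglyMeasurable fun t => ∫ y in (g a)..(g t), g.pullback a b h y :=
    hc.stronglyMeasurable.comp_measurable g.monotone'.measurable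
  refine h1.aestronglyMeasurable.congr ?_
  filter_upwards [ae_restrict_mem measurableSet_Ico] with t ht
  exact (setIntegral_eq_pullback hh (Ico_subset_Icc_self ht)).symm

/-- If `P (γ y) y` holds for almost every `y`, where `γ` is the generalized inverse of `g`, then
`P t (g t)` holds for `μ_g`-almost every `t ∉ D_g`. -/
theorem ae_of_ae_pullback (hab : a ≤ b) {P : ℝ → ℝ → Prop}
    (hP : ∀ᵐ y : ℝ, y ∈ Ico (g a) (g b) → P (g.pseudoInv a b y) y) :
    ∀ᵐ t ∂(g.measure.restrict (Ico a b)), t ∉ g.D → P t (g t) := by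
  rw [← g.map_pseudoInv hab]
  have hm := (g.monotone_pseudoInv hab).measurable
  obtain ⟨N, hN, hNm, hN0⟩ := exists_measurable_superset_of_null
    ((ae_iff.1 hP))
  have hG : Measurable g.toFun := g.monotone'.measurable
  have hA : MeasurableSet {t | t ∉ g.D ∧ g t ∈ N} :=
    g.countable_D.measurableSet.compl.inter (hG hNm)
  by_contra hcon
  -- If γ(y) ∉ `D` then g(γ(y)) = y, so the preimage under γ of the bad points lies in the null set
  -- N.
  have h0 : (volume.restrict (Ico (g a) (g b))).map (g.pseudoInv a b)
      {t | t ∉ g.D ∧ g t ∈ N ∧ g.pseudoInv a b (g t) = t} = 0 := by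
    refine measure_mono_null (t := {t | t ∉ g.D ∧ g t ∈ N}) (fun t ht => ⟨ht.1, ht.2.1⟩) ?_
    rw [Measure.map_apply hm hA, Measure.restrict_apply (hm hA)]
    refine measure_mono_null ?_ hN0
    rintro y ⟨⟨h1, h2⟩, hy⟩
    rwa [g.eq_of_pseudoInv_notMem_D hab hy h1] at h2
  have hgood : ∀ᵐ t ∂(volume.restrict (Ico (g a) (g b))).map (g.pseudoInv a b),
      t ∉ g.D → g.pseudoInv a b (g t) = t ∧ g t ∈ Ico (g a) (g b) := by
    have hB : MeasurableSet {t | t ∉ g.D → g.pseudoInv a b (g t) = t ∧ g t ∈ Ico (g a) (g b)} := by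
      have e : {t | t ∉ g.D → g.pseudoInv a b (g t) = t ∧ g t ∈ Ico (g a) (g b)}
          = g.D ∪ ({t | g.pseudoInv a b (g t) = t} ∩ g.toFun ⁻¹' Ico (g a) (g b)) := by
        ext t
        by_cases h : t ∈ g.D <;> simp [h]
      rw [e]
      exact g.countable_D.measurableSet.union
        ((measurableSet_eq_fun (hm.comp hG) measurable_id).inter (hG measurableSet_Ico))
    rw [ae_map_iff hm.aemeasurable hB]
    filter_upwards [ae_restrict_mem measurableSet_Ico] with y hy hD
    rw [g.eq_of_pseudoInv_notMem_D hab hy hD]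
    exact ⟨rfl, hy⟩
  refine hcon ?_
  filter_upwards [hgood, measure_eq_zero_iff_ae_notMem.1 h0] with t ht hn hD
  obtain ⟨h1, h2⟩ := ht hD
  by_contra hPn
  refine hn ⟨hD, hN fun hall => hPn ?_, h1⟩
  have := hall h2
  rwa [h1] at this

theorem ae_ne_left_of_notMem_D (g : Derivator) (a : ℝ) : ∀ᵐ t ∂g.measure, t = a → t ∈ g.D := by
  by_cases ha : a ∈ g.D
  · exact Eventually.of_forall fun t ht => ht ▸ ha
  · have : g.measure {a} = 0 := by rw [g.measure_singleton, g.jump_eq_zero ha]; simp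
    filter_upwards [measure_eq_zero_iff_ae_notMem.1 this] with t ht h
    exact absurd h ht

/-- Dominated convergence, as the indicators of `Ico t s` decrease to that of the atom. It yields
the derivative at jumps, where the pullback gives no information. -/
theorem tendsto_setIntegral_Ico_singleton (hh : IntegrableOn h (Ico a b) g.measure) {t : ℝ}
    (ht : t ∈ Ico a b) :
    Tendsto (fun s => ∫ r in Ico t s, h r ∂g.measure) (𝓝[Ioc t b] t)
      (𝓝 (∫ r in {t}, h r ∂g.measure)) := by
  have ht' : IntegrableOn h (Ico t b) g.measure := hh.mono_set (Ico_subset_Ico_left ht.1)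
  simp_rw [← integral_indicator (measurableSet_singleton t), ← integral_indicator measurableSet_Ico]
  refine tendsto_integral_filter_of_dominated_convergence
    ((Ico t b).indicator fun r => ‖h r‖) ?_ ?_ ((integrable_indicator_iff measurableSet_Ico).2 ht'.norm) ?_
  · filter_upwards [self_mem_nhdsWithin] with s hs
    exact ((ht'.mono_set (Ico_subset_Ico_right hs.2)).integrable_indicator measurableSet_Ico).1
  · filter_upwards [self_mem_nhdsWithin] with s hs
    refine Eventually.of_forall fun r => ?_
    rw [norm_indicator_eq_indicator_norm]
    exact indicator_le_indicator_of_subset (Ico_subset_Ico_right hs.2) (fun _ => norm_nonneg _) r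
  · refine Eventually.of_forall fun r => tendsto_const_nhds.congr' ?_
    rcases lt_trichotomy r t with hr | rfl | hr
    · refine Eventually.of_forall fun s => ?_
      dsimp only
      rw [indicator_of_notMem (s := {t}) hr.ne, indicator_of_notMem fun h => not_lt.2 h.1 hr]
    · filter_upwards [self_mem_nhdsWithin] with s hs
      rw [indicator_of_mem (mem_singleton r), indicator_of_mem (s := Ico r s) ⟨le_rfl, hs.1⟩]
    · filter_upwards [mem_nhdsWithin_of_mem_nhds (Iio_mem_nhds hr)] with s hs
      rw [indicator_of_notMem (s := {t}) hr.ne', indicator_of_notMem fun h => lt_asymm h.2 hs]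

/-- Differentiation of the indefinite integral with respect to `μ_g`. -/
theorem ae_hasQuotientLimit_setIntegral (hh : IntegrableOn h (Ico a b) g.measure) :
    ∀ᵐ t ∂(g.measure.restrict (Ico a b)), t ∉ g.C →
      g.HasQuotientLimit (fun t => ∫ s in Ico a t, h s ∂g.measure) (g.quotSet a b t) t (h t) := by
  rcases le_or_gt b a with hab | hab
  · simp [Ico_eq_empty (not_lt.2 hab)]
  have hder := LocallyIntegrable.ae_hasDerivAt_integral
    (integrable_pullback hab.le hh).locallyIntegrable
  have hder' := ae_of_ae_pullback (g := g) hab.le (P := fun t y =>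
      HasDerivAt (fun x => ∫ r in (g a)..x, g.pullback a b h r) (h t) y) (by
    filter_upwards [hder] with y hy hy'
    have := hy (g a)
    rwa [pullback, indicator_of_mem hy'] at this)
  filter_upwards [hder', ae_restrict_mem measurableSet_Ico,
    ae_restrict_of_ae (g.ae_ne_left_of_notMem_D a)] with t ht htm hta hC
  have hne := g.neBot_quotSet hC htm hta
  refine ⟨hne, ?_⟩
  by_cases hD : t ∈ g.D
  · have hj : g.jump t ≠ 0 := ne_of_gt hD
    have hI := tendsto_setIntegral_Ico_singleton hh htm
    rw [integral_singleton, g.measureReal_singleton] at hI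
    have hsub : g.quotSet a b t ⊆ Ioc t b := fun s hs => ⟨hs.2.2 hD, hs.1.2⟩
    have h1 := hI.mono_left (nhdsWithin_mono t hsub)
    have h2 : Tendsto (fun s => ((g s - g t : ℝ) : 𝕜)) (𝓝[g.quotSet a b t] t)
      (𝓝 (g.jump t : 𝕜)) :=
      (RCLike.continuous_ofReal.tendsto _).comp (g.tendsto_sub_quotSet a b t)
    have h3 := h1.div h2 (by exact_mod_cast hj)
    have h4 : g.jump t • h t / (g.jump t : 𝕜) = h t := by
      rw [RCLike.real_smul_eq_coe_mul, mul_div_cancel_left₀]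
      exact_mod_cast hj
    rw [h4] at h3
    refine h3.congr' ?_
    filter_upwards [self_mem_nhdsWithin] with s hs
    rw [Pi.div_apply, setIntegral_Ico_sub hh htm.1 (hsub hs).1.le hs.1.2]
  -- At a continuity point, g(s) tends to g(t) avoiding it, so the slope of the Lebesgue primitive
  -- can be composed with `g`.
  · have hd := (hasDerivAt_iff_tendsto_slope.1 (ht hD))
    have h1 : Tendsto g (𝓝[g.quotSet a b t] t) (𝓝[≠] (g t)) := by
      refine tendsto_nhdsWithin_iff.2 ⟨(g.continuousAt hD).tendsto.mono_left nhdsWithin_le_nhds, ?_⟩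
      filter_upwards [self_mem_nhdsWithin] with s hs
      exact hs.2.1
    refine (hd.comp h1).congr' ?_
    filter_upwards [self_mem_nhdsWithin] with s hs
    rw [Function.comp, slope, vsub_eq_sub, ← setIntegral_eq_pullback hh hs.1,
      ← setIntegral_eq_pullback hh (Ico_subset_Icc_self htm), RCLike.real_smul_eq_coe_mul,
      RCLike.ofReal_inv, div_eq_inv_mul]

end Differentiation

/-! ### Embedding `𝕜` into ℂ. -/

section ToComplex

theorem map_complex_mul (x y : 𝕜) :
    RCLike.map 𝕜 ℂ (x * y) = RCLike.map 𝕜 ℂ x * RCLike.map 𝕜 ℂ y := by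
  apply Complex.ext <;> simp [RCLike.map_apply, RCLike.mul_re, RCLike.mul_im]

theorem map_complex_ofReal (r : ℝ) : RCLike.map 𝕜 ℂ (r : 𝕜) = r := by
  simp [RCLike.map_apply]

theorem map_complex_one : RCLike.map 𝕜 ℂ (1 : 𝕜) = 1 := by
  simp [RCLike.map_apply]

theorem map_map_complex (x : 𝕜) : RCLike.map ℂ 𝕜 (RCLike.map 𝕜 ℂ x) = x := by
  simp [RCLike.map_apply]

theorem norm_map_complex (x : 𝕜) : ‖RCLike.map 𝕜 ℂ x‖ = ‖x‖ := by
  rw [← sq_eq_sq₀ (norm_nonneg _) (norm_nonneg _), RCLike.norm_sq_eq_def, RCLike.norm_sq_eq_def]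
  simp [RCLike.map_apply]

theorem map_complex_injective : Function.Injective (RCLike.map 𝕜 ℂ) :=
  Function.LeftInverse.injective map_map_complex

end ToComplex

/-- For modifications on `D`, which is countable but carries the atoms, so almost-everywhere
equality is not available. -/
theorem aestronglyMeasurable_of_countable_ne {μ : Measure ℝ} {φ ψ : ℝ → 𝕜}
    (hφ : AEStronglyMeasurable φ μ) (h : {t | φ t ≠ ψ t}.Countable) :
    AEStronglyMeasurable ψ μ := by
  have h1 : Measurable fun t => ψ t - φ t := by
    refine (measurable_const (a := (0 : 𝕜))).measurable_of_countable_ne (h.mono fun t ht => ?_)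
    simpa [sub_eq_zero, eq_comm] using ht
  exact (hφ.add h1.stronglyMeasurable.aestronglyMeasurable).congr
    (Eventually.of_forall fun t => add_sub_cancel (φ t) (ψ t))

/-! ### The `g`-exponential. -/

section Beta

variable {g : Derivator} {β : ℝ → 𝕜} {T : ℝ}

/-- An integrable function has only finitely many large jumps. -/
theorem finite_half_le_jump (hβ : IntegrableOn β (Ico 0 T) g.measure) :
    {t | t ∈ Ico 0 T ∧ 1 / 2 ≤ ‖β t‖ * g.jump t}.Finite := by
  set S := Ico 0 T ∩ g.D with hS
  have hc : S.Countable := g.countable_D.mono inter_subset_right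
  -- This sum is the integral of |β| over the atoms, so only finitely many terms reach 1/2.
  have h1 : ∑' a : S, ‖β a‖ₑ * g.measure {(a : ℝ)} ≠ ⊤ := by
    rw [← lintegral_countable (fun a => ‖β a‖ₑ) hc]
    exact (hβ.mono_set inter_subset_left).2.ne
  have h2 := (ENNReal.finite_const_le_of_tsum_ne_top h1
    (ε := ENNReal.ofReal (1 / 2)) (by simp)).image Subtype.val
  refine h2.subset fun t ht => ?_
  have hD : t ∈ g.D := by
    by_contra h
    have := ht.2
    rw [g.jump_eq_zero h, mul_zero] at this
    norm_num at this
  refine ⟨⟨t, ht.1, hD⟩, ?_, rfl⟩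
  change ENNReal.ofReal (1 / 2) ≤ ‖β t‖ₑ * g.measure {t}
  rw [g.measure_singleton, ← ofReal_norm, ← ENNReal.ofReal_mul (norm_nonneg _)]
  exact ENNReal.ofReal_le_ofReal ht.2

theorem norm_mul_jump (β : ℝ → 𝕜) (t : ℝ) : ‖β t * (g.jump t : 𝕜)‖ = ‖β t‖ * g.jump t := by
  rw [norm_mul, RCLike.norm_ofReal, abs_of_nonneg (g.jump_nonneg t)]

theorem finite_zeroSet (hβ : IntegrableOn β (Ico 0 T) g.measure) : (g.zeroSet β T).Finite := by
  refine (finite_half_le_jump hβ).subset fun t ht => ⟨ht.1.1, ?_⟩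
  rw [← norm_mul_jump, eq_neg_of_add_eq_zero_right ht.2]
  norm_num

theorem tZero_mem_Icc (hT : 0 < T) (hβ : IntegrableOn β (Ico 0 T) g.measure) :
    g.tZero β T ∈ Icc 0 T := by
  rw [tZero]
  split_ifs with h
  · exact Ico_subset_Icc_self (h.csInf_mem (finite_zeroSet hβ)).1.1
  · exact ⟨hT.le, le_rfl⟩

theorem one_add_ne_zero (hT : 0 < T) (hβ : IntegrableOn β (Ico 0 T) g.measure) {t : ℝ}
    (ht : t ∈ Ico 0 (g.tZero β T)) : 1 + β t * (g.jump t : 𝕜) ≠ 0 := by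
  intro h
  have hD : t ∈ g.D := by
    by_contra hD
    rw [g.jump_eq_zero hD] at h
    simp at h
  have hmem : t ∈ g.zeroSet β T := ⟨⟨⟨ht.1, ht.2.trans_le (tZero_mem_Icc hT hβ).2⟩, hD⟩, h⟩
  have h1 := ht.2
  rw [tZero, if_pos ⟨t, hmem⟩] at h1
  exact absurd (csInf_le (finite_zeroSet hβ).bddBelow hmem) (not_le.2 h1)

theorem integrableOn_of_finite (g : Derivator) (h : ℝ → 𝕜) {S : Set ℝ} (hS : S.Finite) :
    IntegrableOn h S g.measure := by
  rw [← biUnion_of_singleton S, integrableOn_finite_biUnion hS]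
  exact fun t _ => integrableOn_singleton (by finiteness)
    (by rw [g.measure_singleton]; exact ENNReal.ofReal_lt_top)

/-- Off the finite set Q, |log(1 + z)| ≤ (3/2)|z| with z = βΔ. Points of Q have finite mass,
including those with 1 + βΔ = 0, where the logarithm takes the default value 0. -/
theorem integrableOn_betaTilde (hβ : IntegrableOn β (Ico 0 T) g.measure) :
    IntegrableOn (g.betaTilde β) (Ico 0 T) g.measure := by
  set Q := {t | t ∈ Ico 0 T ∧ 1 / 2 ≤ ‖β t‖ * g.jump t} with hQ
  have hfin : Q.Finite := finite_half_le_jump hβ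
  have hmeas : AEStronglyMeasurable (g.betaTilde β) (g.measure.restrict (Ico 0 T)) := by
    refine aestronglyMeasurable_of_countable_ne
      ((RCLike.map 𝕜 ℂ).continuous.comp_aestronglyMeasurable hβ.1)
      (g.countable_D.mono fun t ht => ?_)
    by_contra hD
    exact ht (by rw [betaTilde, if_neg hD])
  have h1 : IntegrableOn (g.betaTilde β) (Ico 0 T \ Q) g.measure := by
    have hsub : Ico 0 T \ Q ⊆ Ico 0 T := sdiff_subset
    refine Integrable.mono' (g := fun t => 3 / 2 * ‖β t‖)
      ((hβ.mono_set hsub).norm.const_mul _) (hmeas.mono_set hsub) ?_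
    filter_upwards [ae_restrict_mem (measurableSet_Ico.diff hfin.measurableSet)] with t ht
    rw [betaTilde]
    split_ifs with hD
    · have hj : 0 < g.jump t := hD
      have hlt : ‖β t‖ * g.jump t < 1 / 2 := not_le.1 fun h => ht.2 ⟨ht.1, h⟩
      have hn : ‖RCLike.map 𝕜 ℂ (β t) * (g.jump t : ℂ)‖ = ‖β t‖ * g.jump t := by
        rw [norm_mul, norm_map_complex, Complex.norm_real, Real.norm_of_nonneg hj.le]
      have h2 := Complex.norm_log_one_add_half_le_self (hn.trans_le hlt.le)
      rw [hn] at h2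
      rw [norm_div, Complex.norm_real, Real.norm_of_nonneg hj.le, div_le_iff₀ hj]
      linarith
    · rw [norm_map_complex]
      linarith [norm_nonneg (β t)]
  have h2 := h1.union (g.integrableOn_of_finite (g.betaTilde β) hfin)
  exact h2.mono_set fun t ht => by
    by_cases h : t ∈ Q
    · exact Or.inr h
    · exact Or.inl ⟨ht, h⟩

/-- In the real case β̃ is real except at the finitely many jumps with 1 + βΔ < 0. There its
imaginary part is π/Δ, and the atom of mass Δ contributes π. -/
theorem exists_nat_setIntegral_betaTilde_im (hI : (RCLike.I : 𝕜) = 0)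
    (hβ : IntegrableOn β (Ico 0 T) g.measure) {t : ℝ} (ht : t ≤ T) :
    ∃ n : ℕ, (∫ s in Ico 0 t, g.betaTilde β s ∂g.measure).im = n * Real.pi := by
  have hreal : ∀ x : 𝕜, RCLike.map 𝕜 ℂ x = ((RCLike.re x : ℝ) : ℂ) := by
    intro x
    have h1 : RCLike.im x = 0 := by
      rw [← RCLike.re_add_im x]
      simp [hI]
    simp [RCLike.map_apply, h1]
  set P := {s | s ∈ Ico 0 t ∩ g.D ∧ 1 + RCLike.re (β s) * g.jump s < 0} with hP
  have hPfin : P.Finite := by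
    refine (finite_half_le_jump hβ).subset fun s hs => ⟨⟨hs.1.1.1, hs.1.1.2.trans_le ht⟩, ?_⟩
    have h1 := mul_le_mul_of_nonneg_right ((neg_le_abs _).trans (RCLike.abs_re_le_norm (β s)))
      (g.jump_nonneg s)
    linarith [hs.2]
  have him : ∀ s ∈ Ico 0 t, (g.betaTilde β s).im
      = P.indicator (fun s => Real.pi / g.jump s) s := by
    intro s hs
    rw [betaTilde, hreal]
    by_cases hD : s ∈ g.D
    · have h1 : (1 + ((RCLike.re (β s) : ℝ) : ℂ) * (g.jump s : ℂ))
          = ((1 + RCLike.re (β s) * g.jump s : ℝ) : ℂ) := by push_cast; rfl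
      rw [if_pos hD, h1, Complex.div_ofReal_im, Complex.log_im]
      by_cases hneg : 1 + RCLike.re (β s) * g.jump s < 0
      · rw [Complex.arg_ofReal_of_neg hneg, indicator_of_mem (s := P) ⟨⟨hs, hD⟩, hneg⟩]
      · rw [Complex.arg_ofReal_of_nonneg (not_lt.1 hneg), zero_div,
          indicator_of_notMem fun h => hneg h.2]
    · rw [if_neg hD, Complex.ofReal_im, indicator_of_notMem fun h => hD h.1.2]
  have hint := (integrableOn_betaTilde hβ).mono_set (Ico_subset_Ico_right ht)
  refine ⟨hPfin.toFinset.card, ?_⟩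
  have h1 := Complex.imCLM.integral_comp_comm hint
  simp only [Complex.imCLM_apply] at h1
  rw [← h1, setIntegral_congr_fun measurableSet_Ico him, setIntegral_indicator
    hPfin.measurableSet, inter_eq_right.2 fun s hs => hs.1.1]
  have h2 : ∀ ψ : ℝ → ℝ, ∫ s in P, ψ s ∂g.measure
      = ∫ s in ⋃ s ∈ hPfin.toFinset, {s}, ψ s ∂g.measure := by simp
  rw [h2, integral_biUnion_finset _ (fun _ _ => measurableSet_singleton _)
    (fun i _ j _ hij => disjoint_singleton.2 hij)
    (fun i _ => by simpa using g.integrableOn_of_finite (𝕜 := ℝ) _ (finite_singleton i))]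
  rw [Finset.sum_congr rfl (g := fun _ => Real.pi)]
  · simp
  · intro s hs
    have hj : g.jump s ≠ 0 := ne_of_gt ((hPfin.mem_toFinset.1 hs).1.2)
    rw [integral_singleton, g.measureReal_singleton, smul_eq_mul, mul_div_cancel₀ _ hj]

/-- The complex exponential defining `gExp` takes values in `𝕜`. -/
theorem map_gExp (hT : 0 < T) (hβ : IntegrableOn β (Ico 0 T) g.measure) {t : ℝ}
    (ht : t ∈ Icc 0 (g.tZero β T)) :
    RCLike.map 𝕜 ℂ (g.gExp β T t) = Complex.exp (∫ s in Ico 0 t, g.betaTilde β s ∂g.measure) := by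
  obtain ⟨x, hx⟩ : ∃ x : 𝕜,
      RCLike.map 𝕜 ℂ x = Complex.exp (∫ s in Ico 0 t, g.betaTilde β s ∂g.measure) := by
    -- Real case: the imaginary part of the exponent is a multiple of π, so its exponential is real.
    -- Complex case: every complex number is attained.
    rcases RCLike.I_eq_zero_or_im_I_eq_one (K := 𝕜) with hI | hI
    · obtain ⟨n, hn⟩ := exists_nat_setIntegral_betaTilde_im hI hβ
        (ht.2.trans (tZero_mem_Icc hT hβ).2)
      refine ⟨((Complex.exp (∫ s in Ico 0 t, g.betaTilde β s ∂g.measure)).re : 𝕜), ?_⟩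
      rw [map_complex_ofReal]
      apply Complex.ext
      · simp
      · rw [Complex.ofReal_im, Complex.exp_im, hn, Real.sin_nat_mul_pi, mul_zero]
    · set z := Complex.exp (∫ s in Ico 0 t, g.betaTilde β s ∂g.measure)
      refine ⟨(z.re : 𝕜) + (z.im : 𝕜) * RCLike.I, ?_⟩
      apply Complex.ext <;> simp [RCLike.map_apply, hI]
  rw [gExp, if_pos ht.2, ← hx, map_map_complex]

theorem gExp_ne_zero (hT : 0 < T) (hβ : IntegrableOn β (Ico 0 T) g.measure) {t : ℝ}
    (ht : t ∈ Icc 0 (g.tZero β T)) : g.gExp β T t ≠ 0 := by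
  intro h
  have h1 := map_gExp hT hβ ht
  rw [h, map_zero] at h1
  exact Complex.exp_ne_zero _ h1.symm

theorem gExp_zero (hT : 0 < T) (hβ : IntegrableOn β (Ico 0 T) g.measure) :
    g.gExp β T 0 = 1 := by
  refine map_complex_injective ?_
  rw [map_gExp hT hβ ⟨le_rfl, (tZero_mem_Icc hT hβ).1⟩, map_complex_one]
  simp

/-- The exponent is bounded, being a `g`-absolutely continuous primitive. -/
theorem exists_le_norm_gExp (hT : 0 < T) (hβ : IntegrableOn β (Ico 0 T) g.measure) :
    ∃ c > 0, ∀ t ∈ Icc 0 (g.tZero β T), c ≤ ‖g.gExp β T t‖ := by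
  obtain ⟨M, hM⟩ := (absCont_setIntegral (integrableOn_betaTilde hβ)).exists_forall_norm_le
  refine ⟨Real.exp (-M), Real.exp_pos _, fun t ht => ?_⟩
  rw [← norm_map_complex, map_gExp hT hβ ht, Complex.norm_exp, Real.exp_le_exp]
  have h1 := hM t ⟨ht.1, ht.2.trans (tZero_mem_Icc hT hβ).2⟩
  linarith [neg_le_abs (∫ s in Ico 0 t, g.betaTilde β s ∂g.measure).re,
    Complex.abs_re_le_norm (∫ s in Ico 0 t, g.betaTilde β s ∂g.measure)]

theorem absCont_gExp (hT : 0 < T) (hβ : IntegrableOn β (Ico 0 T) g.measure) :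
    g.AbsCont 0 (g.tZero β T) (g.gExp β T) := by
  have hI := (absCont_setIntegral (integrableOn_betaTilde hβ)).mono_right (tZero_mem_Icc hT hβ).2
  obtain ⟨M, hM⟩ := hI.exists_forall_norm_le
  refine hI.of_norm_sub_le hI (Real.exp M) fun p hp q hq => ?_
  rw [← norm_map_complex, map_sub, map_gExp hT hβ hp, map_gExp hT hβ hq]
  have h1 := (convex_closedBall (0 : ℂ) M).norm_image_sub_le_of_norm_hasDerivWithin_le
    (f := Complex.exp) (f' := Complex.exp) (C := Real.exp M)
    (fun x _ => (Complex.hasDerivAt_exp x).hasDerivWithinAt)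
    (fun x hx => (Complex.norm_exp_le_exp_norm x).trans
      (Real.exp_le_exp.2 (mem_closedBall_zero_iff.1 hx)))
    (mem_closedBall_zero_iff.2 (hM p hp)) (mem_closedBall_zero_iff.2 (hM q hq))
  refine h1.trans (mul_le_mul_of_nonneg_left ?_ (Real.exp_pos M).le)
  exact le_add_of_nonneg_right (norm_nonneg _)

/-- At a jump, exp(c + β̃Δ) − exp(c) = exp(c)βΔ, and Δ cancels; elsewhere the slope is the
derivative of exp. Using `dslope` avoids treating β̃ = 0 separately. -/
theorem dslope_exp_mul_betaTilde {t : ℝ} (h : 1 + β t * (g.jump t : 𝕜) ≠ 0) (c : ℂ) :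
    dslope Complex.exp c (c + g.betaTilde β t * (g.jump t : ℂ)) * g.betaTilde β t
      = Complex.exp c * RCLike.map 𝕜 ℂ (β t) := by
  by_cases hD : t ∈ g.D
  · have hj : (g.jump t : ℂ) ≠ 0 := by exact_mod_cast ne_of_gt (show 0 < g.jump t from hD)
    have h1 : 1 + RCLike.map 𝕜 ℂ (β t) * (g.jump t : ℂ) ≠ 0 := by
      rw [← map_complex_one (𝕜 := 𝕜), ← map_complex_ofReal (𝕜 := 𝕜), ← map_complex_mul,
        ← map_add]
      exact fun e => h (map_complex_injective (e.trans (map_zero _).symm))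
    have h2 : Complex.exp (g.betaTilde β t * (g.jump t : ℂ))
        = 1 + RCLike.map 𝕜 ℂ (β t) * (g.jump t : ℂ) := by
      rw [betaTilde, if_pos hD, div_mul_cancel₀ _ hj, Complex.exp_log h1]
    have h3 := sub_smul_dslope Complex.exp c (c + g.betaTilde β t * (g.jump t : ℂ))
    rw [add_sub_cancel_left, Complex.exp_add, h2, smul_eq_mul] at h3
    refine mul_right_cancel₀ hj ?_
    linear_combination h3
  · rw [g.jump_eq_zero hD, betaTilde, if_neg hD]
    simp

/-- The `g`-exponential solves the homogeneous equation. -/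
theorem ae_hasQuotientLimit_gExp (hT : 0 < T) (hβ : IntegrableOn β (Ico 0 T) g.measure) :
    ∀ᵐ t ∂(g.measure.restrict (Ico 0 (g.tZero β T))), t ∉ g.C →
      g.HasQuotientLimit (g.gExp β T) (g.quotSet 0 (g.tZero β T) t) t (β t * g.gExp β T t) := by
  have hτ := tZero_mem_Icc hT hβ
  have hint := (integrableOn_betaTilde hβ).mono_set (Ico_subset_Ico_right hτ.2)
  filter_upwards [ae_hasQuotientLimit_setIntegral hint, ae_restrict_mem measurableSet_Ico]
    with t ht htm hC
  have h1 := ((ht hC).comp_differentiableAt (φ := Complex.exp)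
    Complex.differentiableAt_exp Complex.continuous_exp.continuousAt)
  have e1 : ∀ r : ℝ, ((r : ℝ) : ℂ) = (RCLike.ofReal r : ℂ) := fun _ => rfl
  have h2 := dslope_exp_mul_betaTilde (one_add_ne_zero hT hβ htm)
    (∫ s in Ico 0 t, g.betaTilde β s ∂g.measure)
  rw [e1] at h2
  rw [h2, ← map_gExp hT hβ (Ico_subset_Icc_self htm), ← map_complex_mul] at h1
  -- The derivative was computed in ℂ; a real-linear map brings it back to `𝕜`.
  have h3 := h1.map (RCLike.map ℂ 𝕜)
  rw [map_map_complex, mul_comm] at h3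
  refine h3.congr (fun s hs => ?_) (Ico_subset_Icc_self htm)
  rw [gExp, if_pos hs.2]

end Beta

theorem HasQuotientLimit.inv {g : Derivator} {F : ℝ → 𝕜} {a b t : ℝ} {d : 𝕜}
    (hF : g.HasQuotientLimit F (g.quotSet a b t) t d) (h0 : F t ≠ 0)
    (h1 : F t + d * (g.jump t : 𝕜) ≠ 0) :
    g.HasQuotientLimit (fun s => (F s)⁻¹) (g.quotSet a b t) t
      (-(d * ((F t + d * (g.jump t : 𝕜))⁻¹ * (F t)⁻¹))) := by
  refine ⟨hF.1, ((hF.2.mul ((hF.tendsto.inv₀ h1).mul_const (F t)⁻¹)).neg).congr' ?_⟩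
  filter_upwards [hF.tendsto.eventually_ne h1] with s hs
  have : (F s)⁻¹ - (F t)⁻¹ = -((F s - F t) * ((F s)⁻¹ * (F t)⁻¹)) := by field_simp; ring
  rw [this]
  ring

/-! ### Variation of constants, uniqueness and the Green's function. -/

section Solution

variable {g : Derivator} {β f : ℝ → 𝕜} {v₀ : 𝕜} {T : ℝ}

theorem aestronglyMeasurable_gExp (hT : 0 < T) (hβ : IntegrableOn β (Ico 0 T) g.measure) :
    AEStronglyMeasurable (g.gExp β T) (g.measure.restrict (Ico 0 (g.tZero β T))) := by
  have hint := (integrableOn_betaTilde hβ).mono_set (Ico_subset_Ico_right (tZero_mem_Icc hT hβ).2)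
  refine (((RCLike.map ℂ 𝕜).continuous.comp Complex.continuous_exp).comp_aestronglyMeasurable
    (aestronglyMeasurable_setIntegral hint)).congr ?_
  filter_upwards [ae_restrict_mem measurableSet_Ico] with t ht
  rw [gExp, if_pos ht.2.le]
  rfl

/-- Off the finite set Q, |1 + βΔ| ≥ 1/2 and |E| ≥ c, so the integrand is at most 2|f|/c. -/
theorem integrableOn_vocIntegrand (hT : 0 < T) (hβ : IntegrableOn β (Ico 0 T) g.measure)
    (hf : IntegrableOn f (Ico 0 T) g.measure) :
    IntegrableOn (g.vocIntegrand β f T) (Ico 0 (g.tZero β T)) g.measure := by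
  have hτ := tZero_mem_Icc hT hβ
  have hf' := hf.mono_set (Ico_subset_Ico_right hτ.2)
  obtain ⟨c, hc, hcE⟩ := exists_le_norm_gExp hT hβ
  set Q := {t | t ∈ Ico 0 T ∧ 1 / 2 ≤ ‖β t‖ * g.jump t} with hQ
  have hfin : Q.Finite := finite_half_le_jump hβ
  have hquot : AEStronglyMeasurable (fun s => f s / (1 + β s * (g.jump s : 𝕜)))
      (g.measure.restrict (Ico 0 (g.tZero β T))) := by
    refine aestronglyMeasurable_of_countable_ne hf'.1 (g.countable_D.mono fun t ht => ?_)
    by_contra hD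
    exact ht (by simp [g.jump_eq_zero hD])
  have hmeas : AEStronglyMeasurable (g.vocIntegrand β f T)
      (g.measure.restrict (Ico 0 (g.tZero β T))) :=
    (aestronglyMeasurable_gExp hT hβ).aemeasurable.inv.aestronglyMeasurable.mul hquot
  have h1 : IntegrableOn (g.vocIntegrand β f T) (Ico 0 (g.tZero β T) \ Q) g.measure := by
    have hsub : Ico 0 (g.tZero β T) \ Q ⊆ Ico 0 (g.tZero β T) := sdiff_subset
    refine Integrable.mono' (g := fun t => c⁻¹ * 2 * ‖f t‖)
      ((hf'.mono_set hsub).norm.const_mul _) (hmeas.mono_set hsub) ?_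
    filter_upwards [ae_restrict_mem (measurableSet_Ico.diff hfin.measurableSet)] with t ht
    have hlt : ‖β t * (g.jump t : 𝕜)‖ < 1 / 2 := by
      rw [norm_mul_jump]
      exact not_le.1 fun h => ht.2 ⟨⟨ht.1.1, ht.1.2.trans_le hτ.2⟩, h⟩
    have h2 : 1 / 2 ≤ ‖1 + β t * (g.jump t : 𝕜)‖ := by
      have := norm_sub_le (1 + β t * (g.jump t : 𝕜)) (β t * (g.jump t : 𝕜))
      rw [add_sub_cancel_right, norm_one] at this
      linarith
    have h3 : ‖1 + β t * (g.jump t : 𝕜)‖⁻¹ ≤ 2 := by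
      simpa using inv_anti₀ (by norm_num) h2
    have h4 : ‖g.gExp β T t‖⁻¹ ≤ c⁻¹ := inv_anti₀ hc (hcE t (Ico_subset_Icc_self ht.1))
    rw [vocIntegrand, norm_mul, norm_inv, norm_div, div_eq_mul_inv]
    calc ‖g.gExp β T t‖⁻¹ * (‖f t‖ * ‖1 + β t * (g.jump t : 𝕜)‖⁻¹)
        ≤ c⁻¹ * (‖f t‖ * 2) := by gcongr
      _ = c⁻¹ * 2 * ‖f t‖ := by ring
  refine (h1.union (g.integrableOn_of_finite (g.vocIntegrand β f T) hfin)).mono_set fun t ht => ?_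
  by_cases h : t ∈ Q
  · exact Or.inr h
  · exact Or.inl ⟨ht, h⟩

theorem voc_eq_mul (t : ℝ) : g.voc β f v₀ T t
    = (v₀ + ∫ s in Ico 0 t, g.vocIntegrand β f T s ∂g.measure) * g.gExp β T t := by
  rw [voc]; ring

theorem isSolution_voc (hT : 0 < T) (hβ : IntegrableOn β (Ico 0 T) g.measure)
    (hf : IntegrableOn f (Ico 0 T) g.measure) :
    g.IsSolution β f v₀ (g.tZero β T) (g.voc β f v₀ T) := by
  have hk := integrableOn_vocIntegrand hT hβ hf
  refine ⟨?_, ?_, ?_⟩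
  · refine (((absCont_setIntegral hk).const_add v₀).mul (absCont_gExp hT hβ)).congr fun t _ => ?_
    exact (voc_eq_mul t).symm
  · simp [voc, gExp_zero hT hβ]
  · filter_upwards [ae_hasQuotientLimit_setIntegral hk, ae_hasQuotientLimit_gExp hT hβ,
      ae_restrict_mem measurableSet_Ico, ae_restrict_of_ae g.ae_notMem_C] with t ht hE htm hC
    rw [g.hasGDerivAt_iff (Ico_subset_Icc_self htm) hC]
    have h1 : g.HasQuotientLimit (fun t => v₀ + ∫ s in Ico 0 t, g.vocIntegrand β f T s ∂g.measure)
        (g.quotSet 0 (g.tZero β T) t) t (g.vocIntegrand β f T t) := by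
      simpa only [HasQuotientLimit, add_sub_add_left_eq_sub] using ht hC
    have h2 := (h1.mul (hE hC)).congr (fun s _ => (voc_eq_mul s).symm) (Ico_subset_Icc_self htm)
    convert h2 using 1
    have hE0 := gExp_ne_zero hT hβ (Ico_subset_Icc_self htm)
    have hm := one_add_ne_zero hT hβ htm
    rw [voc_eq_mul, vocIntegrand]
    -- The limit of E along `quotSet` is E(1 + βΔ), which cancels the denominator of the integrand.
    have h3 : (g.gExp β T t)⁻¹ * (f t / (1 + β t * (g.jump t : 𝕜)))
        * (g.gExp β T t + β t * g.gExp β T t * (g.jump t : 𝕜)) = f t := by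
      field_simp
    rw [h3]
    ring

theorem IsSolution.eqOn {w v : ℝ → 𝕜} (hT : 0 < T) (hβ : IntegrableOn β (Ico 0 T) g.measure)
    (hw : g.IsSolution β f v₀ (g.tZero β T) w) (hv : g.IsSolution β f v₀ (g.tZero β T) v) :
    EqOn w v (Icc 0 (g.tZero β T)) := by
  obtain ⟨c, hc, hcE⟩ := exists_le_norm_gExp hT hβ
  have hAC := (hw.1.sub hv.1).mul ((absCont_gExp hT hβ).inv hc hcE)
  have key := hAC.eq_of_hasQuotientLimit_zero (by
    filter_upwards [hw.2.2, hv.2.2, ae_hasQuotientLimit_gExp hT hβ,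
      ae_restrict_mem measurableSet_Ico] with t h1 h2 hE htm hC
    have htm' := Ico_subset_Icc_self htm
    rw [g.hasGDerivAt_iff htm' hC] at h1 h2
    have hE0 := gExp_ne_zero hT hβ htm'
    have hm := one_add_ne_zero hT hβ htm
    have h3 : g.gExp β T t + β t * g.gExp β T t * (g.jump t : 𝕜)
        = g.gExp β T t * (1 + β t * (g.jump t : 𝕜)) := by ring
    -- With z = w − v, the two terms of the product rule are βz/(E(1 + βΔ)) and its negative.
    have h4 := (h1.sub h2).mul ((hE hC).inv hE0 (by rw [h3]; exact mul_ne_zero hE0 hm))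
    convert h4 using 1
    rw [h3]
    field_simp
    ring)
  intro t ht
  have h1 := key t ht
  simp only [hw.2.1, hv.2.1, sub_self, zero_mul] at h1
  rcases mul_eq_zero.1 h1 with h | h
  · exact sub_eq_zero.1 h
  · exact absurd (inv_eq_zero.1 h) (gExp_ne_zero hT hβ ht)

theorem green_mul (t s : ℝ) : g.green β T t s * f s
    = (Ico 0 t).indicator (fun s => g.gExp β T t * g.vocIntegrand β f T s) s := by
  rw [green]
  by_cases h : s ∈ Ico 0 t
  · rw [indicator_of_mem h, indicator_of_mem h, vocIntegrand]
    ring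
  · rw [indicator_of_notMem h, indicator_of_notMem h, zero_mul]

theorem integrableOn_green_mul (hT : 0 < T) (hβ : IntegrableOn β (Ico 0 T) g.measure)
    (hf : IntegrableOn f (Ico 0 T) g.measure) {t : ℝ} (ht : t ∈ Icc 0 (g.tZero β T)) :
    IntegrableOn (fun s => g.green β T t s * f s) (Icc 0 T) g.measure := by
  simp_rw [green_mul]
  refine Integrable.integrableOn ((integrable_indicator_iff measurableSet_Ico).2 ?_)
  exact ((integrableOn_vocIntegrand hT hβ hf).mono_set (Ico_subset_Ico_right ht.2)).const_mul _

theorem voc_eq_green (hT : 0 < T) (hβ : IntegrableOn β (Ico 0 T) g.measure) {t : ℝ}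
    (ht : t ∈ Icc 0 (g.tZero β T)) : g.voc β f v₀ T t
      = v₀ * g.gExp β T t + ∫ s in Icc 0 T, g.green β T t s * f s ∂g.measure := by
  simp_rw [green_mul]
  rw [voc, setIntegral_indicator measurableSet_Ico, inter_eq_right.2, integral_const_mul]
  exact fun s hs => ⟨hs.1, hs.2.le.trans (ht.2.trans (tZero_mem_Icc hT hβ).2)⟩

end Solution

end Derivator

end

theorem mainTheorem5 {𝕜 : Type*} [RCLike 𝕜] (g : Derivator) (T : ℝ) (hT : 0 < T)
    (β f : ℝ → 𝕜) (hβ : IntegrableOn β (Ico 0 T) g.measure)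
    (hf : IntegrableOn f (Ico 0 T) g.measure) (v₀ : 𝕜) :
    -- `t_β⁰` and the right-hand side of the formula are well defined
    (g.zeroSet β T).Finite ∧
    (∀ t ∈ Icc 0 (g.tZero β T), g.gExp β T t ≠ 0) ∧
    IntegrableOn (g.vocIntegrand β f T) (Ico 0 (g.tZero β T)) g.measure ∧
    -- the formula gives a solution in `AC_g([0,t_β⁰])`, and it is the only one
    g.IsSolution β f v₀ (g.tZero β T) (g.voc β f v₀ T) ∧
    (∀ w : ℝ → 𝕜, g.IsSolution β f v₀ (g.tZero β T) w →
      EqOn w (g.voc β f v₀ T) (Icc 0 (g.tZero β T))) ∧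
    -- the solution in terms of the Green's function
    (∀ w : ℝ → 𝕜, g.IsSolution β f v₀ (g.tZero β T) w → ∀ t ∈ Icc 0 (g.tZero β T),
      IntegrableOn (fun s => g.green β T t s * f s) (Icc 0 T) g.measure ∧
      w t = v₀ * g.gExp β T t + ∫ s in Icc 0 T, g.green β T t s * f s ∂g.measure) := by
  have hv := Derivator.isSolution_voc (v₀ := v₀) hT hβ hf
  refine ⟨Derivator.finite_zeroSet hβ, fun t ht => Derivator.gExp_ne_zero hT hβ ht,
    Derivator.integrableOn_vocIntegrand hT hβ hf, hv, fun w hw => hw.eqOn hT hβ hv,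
    fun w hw t ht => ⟨Derivator.integrableOn_green_mul hT hβ hf ht, ?_⟩⟩
  rw [hw.eqOn hT hβ hv ht, Derivator.voc_eq_green hT hβ ht]
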